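/- Let $S=\bar S\smallsetminus\{v_1,\dots,v_p\}$ be obtained by removing $p\ge 1$ points (the punctures) from a closed connected oriented surface $\bar S$, with universal covering $\widetilde S$ on which $\pi_1(S)$ acts by deck transformations. An ideal triangulation $\lambda$ of $S$ is a triangulation of $\bar S$ with vertex set $\{v_1,\dots,v_p\}$ (two sides of the same triangle may be glued together); let $\lambda_1,\dots,\lambda_n$ be its edges. A peripheral subgroup of $\pi_1(S)$ is a subgroup generated by the class (for any choice of base point and path) of a small loop around a puncture. An enhanced homomorphism $(r,\{\xi_\pi\})$ consists of a homomorphism $r:\pi_1(S)\to \mathrm{Isom}^+(\mathbb H^3)=\mathrm{PSL}_2(\mathbb C)$ and of a point $\xi_\pi\in\partial_\infty\mathbb H^3=\mathbb{CP}^1$ fixed by $r(\pi)$ for every peripheral subgroup $\pi$, with $\xi_{\gamma\pi\gamma^{-1}}=r(\gamma)\xi_\pi$ for all $\gamma\in\pi_1(S)$. It realizes $\lambda$ if there is a continuous $r$-equivariant map $\widetilde f:\widetilde S\to\mathbb H^3$ (a pleated surface) that sends every lifted edge of $\lambda$ homeomorphically to a complete geodesic and every lifted face of $\lambda$ homeomorphically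 to an ideal triangle, in such a way that the image of a lifted ideal vertex fixed by the peripheral subgroup $\pi$ is $\xi_\pi$. The edge weight $x_i=e^{t+\mathrm i\theta}\in\mathbb C^*$ is then the exponential shear-bend parameter of $\widetilde f$ along $\lambda_i$: lift $\lambda_i$ to an edge separating lifted faces $\widetilde T,\widetilde T'$, and orient its image geodesic as part of the boundary of $\widetilde f(\widetilde T)$; then $t$ is the oriented distance from the orthogonal projection to this geodesic of the third vertex of $\widetilde f(\widetilde T)$ to that of the third vertex of $\widetilde f(\widetilde T')$, and $\theta\in\mathbb R/2\pi\mathbb Z$ is $\pi$ minus the angle of the rotation about the oriented geodesic that sends the half-plane containing $\widetilde f(\widetilde T')$ to the half-plane containing $\widetilde f(\widetilde T)$. (If the oriented geodesic goes from $0$ to $\infty$ and the third vertices are $\zeta$ and $\zeta'$, this means $x_i=-\zeta'/\zeta$.) The total peripheral load of the enhanced homomorphism is $h_r=x_1x_2\cdots x_n$. Let $(r,\{\xi_\pi\})$ be an enhanced homomorphism realizing $\lambda$, and let $\hat r:\pi_1(S)\to\mathrm{SL}_2(\mathbb C)$ be an arbitrary homomorphism lifting $r$. For each $k$ let $\gamma_k\in\pi_1(S)$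 be represented by a small loop going counterclockwise around $v_k$, let $\pi_k$ be the peripheral subgroup generated by $\gamma_k$, and let $a_k$ be the eigenvalue of $\hat r(\gamma_k)$ on the line $\xi_{\pi_k}\subset\mathbb C^2$. Then $$h_r=(-1)^p\,a_1a_2\cdots a_p .$$ Moreover $h_r$ does not depend on the ideal triangulation: if $(r,\{\xi_\pi\})$ realizes two ideal triangulations $\lambda$ and $\lambda'$, the products of the edge weights that it defines on $\lambda$ and on $\lambda'$ are equal. -/

import Mathlib

open Set Filter Topology
open scoped unitInterval ComplexOrder LinearAlgebra.Projectivization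

noncomputable section

namespace PeripheralLoad

/-! ### Oriented surfaces -/

/-- The path `ℓ`, defined on `[0, T]`, stays away from `0`, and its argument increases by exactly
`2π` along it. For a closed path this means that it has winding number `1` around `0`. -/
def WindsOnce (ℓ : ℝ → ℂ) (T : ℝ) : Prop :=
  ∃ θ : ℝ → ℝ, ContinuousOn θ (Icc 0 T) ∧
    (∀ t ∈ Icc 0 T, ℓ t ≠ 0 ∧ ℓ t = ‖ℓ t‖ * Complex.exp (θ t * Complex.I)) ∧
    θ T - θ 0 = 2 * Real.pi

/-- An atlas of a topological surface, with charts in the plane `ℂ`, is oriented if the coordinate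
changes preserve the orientation: they send small counterclockwise circles around a point to
loops of winding number `1` around the image of that point. -/
def IsOrientedAtlas (X : Type*) [TopologicalSpace X] [ChartedSpace ℂ X] : Prop :=
  ∀ e ∈ atlas ℂ X, ∀ e' ∈ atlas ℂ X, ∀ x ∈ e.source ∩ e'.source,
    ∀ᶠ ρ : ℝ in 𝓝[>] 0,
      WindsOnce (fun t => e' (e.symm (e x + ρ * Complex.exp (2 * Real.pi * t * Complex.I))) - e' x) 1

/-! ### Ideal triangulations -/

/-- The standard closed triangle, in barycentric coordinates. -/
abbrev Tri : Type := stdSimplex ℝ (Fin 3)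

/-- The `a`-th vertex of the standard triangle. -/
abbrev Tri.vertex (a : Fin 3) : Tri := stdSimplex.vertex a

/-- The point `(1 - s) x + s y`. -/
def Tri.mix (s : I) (x y : Tri) : Tri :=
  ⟨(1 - (s : ℝ)) • x.1 + (s : ℝ) • y.1,
    convex_stdSimplex ℝ (Fin 3) x.2 y.2 (sub_nonneg.2 s.2.2) s.2.1 (by ring)⟩

/-- The `i`-th side of the standard triangle, travelled from the vertex `i` to the vertex `i + 1`. -/
def Tri.side (i : Fin 3) (s : I) : Tri := Tri.mix s (Tri.vertex i) (Tri.vertex (i + 1))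

/-- A small segment cutting off the `a`-th vertex, at distance `ε` from it. When `s` goes from `0`
to `1`, it goes from the side `[a, a + 1]` to the side `[a, a + 2]`, which is counterclockwise around
`a` if the vertices `0, 1, 2` are in counterclockwise order. -/
def Tri.link (a : Fin 3) (ε s : I) : Tri :=
  Tri.mix ε (Tri.vertex a) (Tri.mix s (Tri.vertex (a + 1)) (Tri.vertex (a + 2)))

/-- The triangle with its vertices deleted. -/
abbrev OpenTri : Type := {x : Tri // ∀ a, x ≠ Tri.vertex a}

/-- The points of the triangle with vertices deleted that are close to the `a`-th vertex. -/
def OpenTri.nhdsVertex (a : Fin 3) : Filter OpenTri := comap Subtype.val (𝓝 (Tri.vertex a))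

/-- A triangulation of the closed surface `X`, with coherently oriented faces: `X` is the quotient
of finitely many triangles whose sides are glued in pairs by orientation-reversing
identifications. Two sides of the same triangle may be glued together. -/
structure Triangulation (X : Type*) [TopologicalSpace X] where
  /-- The faces. -/
  Face : Type
  [fintypeFace : Fintype Face]
  /-- The characteristic map of each face. -/
  char : Face → Tri → X
  continuous_char : ∀ j, Continuous (char j)
  surjective_char : ∀ x, ∃ j y, char j y = x
  /-- The pairing of the sides; `(j, i)` is the `i`-th side of the face `j`. -/
  mate : Equiv.Perm (Face × Fin 3)
  mate_mate : ∀ d, mate (mate d) = d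
  mate_ne : ∀ d, mate d ≠ d
  /-- `X` is the quotient by the equivalence relation generated by the gluing of the sides. -/
  char_eq_iff : ∀ j j' y y', char j y = char j' y' ↔
    Relation.EqvGen (fun P Q : Face × Tri => ∃ (i i' : Fin 3) (s : I),
      mate (P.1, i) = (Q.1, i') ∧ P.2 = Tri.side i s ∧ Q.2 = Tri.side i' (σ s)) (j, y) (j', y')

attribute [instance] Triangulation.fintypeFace

namespace Triangulation

variable {X : Type*} [TopologicalSpace X] (lam : Triangulation X)

/-- The edges: a side and the side that it is glued to are the same edge. -/
def Edge : Type := Quotient (Equiv.Perm.SameCycle.setoid lam.mate)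

instance : Finite lam.Edge := Quotient.finite _

instance : Fintype lam.Edge := Fintype.ofFinite _

/-- The edge corresponding to a side of a face. -/
def edge (d : lam.Face × Fin 3) : lam.Edge := Quotient.mk (Equiv.Perm.SameCycle.setoid lam.mate) d

/-- The vertex of the triangulation at which the corner `c = (j, a)` sits. -/
def vertexAt (c : lam.Face × Fin 3) : X := lam.char c.1 (Tri.vertex c.2)

/-- The corner `(j, a)` is followed, counterclockwise around its vertex, by the corner on the other
side of the side of `j` going from `a + 2` to `a`. -/
def turn (c : lam.Face × Fin 3) : lam.Face × Fin 3 := lam.mate (c.1, c.2 + 2)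

/-- The number of corners around the vertex of the corner `c`. -/
def valence (c : lam.Face × Fin 3) : ℕ := Function.minimalPeriod lam.turn c

/-- The small loop, parametrized by `[0, valence c]`, going around the vertex of `c`, which crosses
the successive corners at this vertex, starting with `c`, at distance `ε` from the vertex. -/
def linkLoop (c : lam.Face × Fin 3) (ε : I) (t : ℝ) : X :=
  lam.char (lam.turn^[⌊t⌋₊] c).1
    (Tri.link (lam.turn^[⌊t⌋₊] c).2 ε ⟨Int.fract t, unitInterval.fract_mem t⟩)

end Triangulation

/-- An ideal triangulation of the oriented punctured surface `X - V`: a triangulation of the closed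
oriented surface `X` with vertex set `V`, whose faces have their vertices `0, 1, 2` in
counterclockwise order for the orientation of `X`. The latter means that turning around a vertex
through the successive corners is going once counterclockwise around it. -/
structure IdealTriangulation {X : Type*} [TopologicalSpace X] [ChartedSpace ℂ X]
    (V : Finset X) extends Triangulation X where
  mem_iff : ∀ v, v ∈ V ↔ ∃ c, toTriangulation.vertexAt c = v
  counterclockwise : ∀ c, ∀ᶠ ε : I in 𝓝[≠] 0,
    WindsOnce (fun t => chartAt ℂ (toTriangulation.vertexAt c) (toTriangulation.linkLoop c ε t) -
        chartAt ℂ (toTriangulation.vertexAt c) (toTriangulation.vertexAt c))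
      (toTriangulation.valence c)

/-! ### The punctured surface, its universal covering and its fundamental group -/

/-- The punctured surface `S = X - V`. -/
abbrev Punctured {X : Type*} (V : Finset X) : Type _ := {x : X // x ∉ V}

/-- The group of deck transformations of `p`. When `p : E → S` is a universal covering, this is the
fundamental group of `S`, with its action on `E`. -/
def Deck {E S : Type*} [TopologicalSpace E] (p : E → S) : Subgroup (E ≃ₜ E) where
  carrier := {g | ∀ y, p (g y) = p y}
  mul_mem' {g h} hg hh y := (hg (h y)).trans (hh y)
  one_mem' _ := rfl
  inv_mem' {g} hg y := by
    have h := hg (g⁻¹ y)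
    have h' : g (g⁻¹ y) = y := g.apply_symm_apply y
    rw [h'] at h
    exact h.symm

section Loops

variable {X : Type*} [TopologicalSpace X] [ChartedSpace ℂ X] {V : Finset X}
  {E : Type*} [TopologicalSpace E]

/-- In the coordinate disc at the puncture `v`, consider the circle centered at `v` which passes
through `p y`, and which bounds a disc containing no other puncture. The circle, travelled
once counterclockwise, lifts to a path in `E` going from `y` to `γ y`. -/
def IsPunctureLoopAt (p : E → Punctured V) (v : X) (y : E) (γ : Deck p) : Prop :=
  let φ := chartAt ℂ v
  let w : ℂ := φ (p y).1 - φ v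
  (p y).1 ∈ φ.source ∧ Metric.closedBall (φ v) ‖w‖ ⊆ φ.target ∧
    (∀ v' ∈ V, v' ∈ φ.symm '' Metric.closedBall (φ v) ‖w‖ → v' = v) ∧
    ∃ q : I → E, Continuous q ∧ q 0 = y ∧ q 1 = γ.1 y ∧
      ∀ t : I, (p (q t)).1 = φ.symm (φ v + w * Complex.exp (2 * Real.pi * (t : ℝ) * Complex.I))

/-- `γ` is the class in the fundamental group, for some choice of base point, of a small loop going
counterclockwise around the puncture `v`. -/
def IsPunctureLoop (p : E → Punctured V) (v : X) (γ : Deck p) : Prop :=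
  ∃ y, IsPunctureLoopAt p v y γ

/-- The peripheral subgroups of the fundamental group: the images of the fundamental groups of small
annulus neighbourhoods of the punctures, for all choices of base points and paths. -/
def peripheralSubgroups (p : E → Punctured V) : Set (Subgroup (Deck p)) :=
  {π | ∃ v ∈ V, ∃ γ, IsPunctureLoop p v γ ∧ π = Subgroup.zpowers γ}

end Loops

/-! ### Hyperbolic 3-space

The hyperboloid model: the space of hermitian `2 × 2` matrices, with the quadratic form `det`, is a
Minkowski space of signature `(1, 3)`. The sphere at infinity, namely the set of isotropic lines, is
the complex projective line `ℙ ℂ (Fin 2 → ℂ)`, where the line spanned by `u` corresponds to the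
isotropic line spanned by the hermitian matrix `u u*`. The group `SL₂(ℂ)` acts by
`P ↦ A P A*`. -/

/-- `SL₂(ℂ)`. -/
abbrev SL2C : Type := Matrix.SpecialLinearGroup (Fin 2) ℂ

/-- `PSL₂(ℂ)`, the group of orientation-preserving isometries of hyperbolic 3-space. -/
abbrev PSL2C : Type := Matrix.ProjectiveSpecialLinearGroup (Fin 2) ℂ

/-- Hyperbolic 3-space. -/
abbrev H3 : Type := {P : Matrix (Fin 2) (Fin 2) ℂ // P.PosDef ∧ P.det = 1}

/-- The sphere at infinity of hyperbolic 3-space. -/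
abbrev Bdry : Type := ℙ ℂ (Fin 2 → ℂ)

/-- The action of `SL₂(ℂ)` on hyperbolic 3-space. -/
def act (A : SL2C) (P : H3) : H3 :=
  ⟨A.1 * P.1 * A.1.conjTranspose, by
    refine ⟨P.2.1.mul_mul_conjTranspose_same ?_, ?_⟩
    · rw [Matrix.vecMul_injective_iff_isUnit, Matrix.isUnit_iff_isUnit_det, A.2]
      exact isUnit_one
    · simp [Matrix.det_mul, Matrix.det_conjTranspose, A.2, P.2.2]⟩

/-- The rank one hermitian matrix `u u*` of trace `1`, where `u` spans the line `z`. -/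
def null (z : Bdry) : Matrix (Fin 2) (Fin 2) ℂ :=
  (star z.rep ⬝ᵥ z.rep)⁻¹ • Matrix.vecMulVec z.rep (star z.rep)

/-- The projection of hyperbolic space to the Klein model, namely the open ball consisting of the
positive definite matrices of trace `1`. Its boundary sphere consists of the `null z`. -/
def klein (P : H3) : Matrix (Fin 2) (Fin 2) ℂ := (P.1.trace)⁻¹ • P.1

/-- Convergence to the point `z` of the sphere at infinity. -/
def TendsToIdeal {α : Type*} (f : α → H3) (l : Filter α) (z : Bdry) : Prop :=
  Tendsto (fun x => klein (f x)) l (𝓝 (null z))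

/-- The complete geodesic with end points `z` and `w`: a straight segment in the Klein model. -/
def geodesic (z w : Bdry) : Set H3 := {P | klein P ∈ openSegment ℝ (null z) (null w)}

/-- The ideal triangle with vertices `z 0, z 1, z 2`: a straight triangle in the Klein model. -/
def idealTriangle (z : Fin 3 → Bdry) : Set H3 :=
  {P | klein P ∈ convexHull ℝ (range fun a => null (z a))}

/-- The half-plane bounded by the geodesic from `z` to `w`, and having `ζ` as an ideal point. -/
def halfPlane (z w ζ : Bdry) : Set H3 :=
  {P | ∃ a b c : ℝ, 0 < c ∧ P.1 = a • null z + b • null w + c • null ζ}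

/-- The polarization of `det` on hermitian matrices, so that `lorentz P Q` is the hyperbolic cosine
of the distance between the points `P` and `Q`. -/
def lorentz (P Q : Matrix (Fin 2) (Fin 2) ℂ) : ℂ := (P.trace * Q.trace - (P * Q).trace) / 2

/-- The unit speed parametrization of the geodesic from `z` to `w`. -/
def geodesicPoint (z w : Bdry) (s : ℝ) : Matrix (Fin 2) (Fin 2) ℂ :=
  (Real.sqrt (2 * (lorentz (null z) (null w)).re))⁻¹ •
    (Real.exp s • null w + Real.exp (-s) • null z)

/-- The velocity of the unit speed parametrization of the geodesic from `z` to `w`. -/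
def geodesicVelocity (z w : Bdry) (s : ℝ) : Matrix (Fin 2) (Fin 2) ℂ :=
  (Real.sqrt (2 * (lorentz (null z) (null w)).re))⁻¹ •
    (Real.exp s • null w - Real.exp (-s) • null z)

/-- The point of parameter `s` is the orthogonal projection of the ideal point `ζ` to the geodesic
from `z` to `w`: the geodesic going from this point to `ζ` is orthogonal to it. (At the
point `P`, the latter has direction `null ζ - c • P` for some real `c`, and the velocity is orthogonal
to `P`.) -/
def IsProjection (z w ζ : Bdry) (s : ℝ) : Prop :=
  lorentz (geodesicVelocity z w s) (null ζ) = 0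

/-- `A` is the rotation of angle `α` about the geodesic directed from `z` to `w`. For `z = 0` and
`w = ∞`, it acts on the complex plane as multiplication by `exp (i α)`. -/
def IsRotation (z w : Bdry) (α : ℝ) (A : SL2C) : Prop :=
  (∀ u ∈ w.submodule, A • u = Complex.exp (α / 2 * Complex.I) • u) ∧
    (∀ u ∈ z.submodule, A • u = Complex.exp (-(α / 2) * Complex.I) • u)

/-- Consider two ideal triangles, with vertices `z, w, ζ` and `z, w, ζ'`, where the first one is
oriented so that `z` to `w` is the boundary orientation of their common edge. Then
`x = exp (t + i θ)`, where the shear parameter `t` is the oriented distance from the projection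
of `ζ` to the projection of `ζ'`, and `θ` is the external dihedral angle, namely `π` minus the angle
`α` of the rotation about the oriented edge that sends the second triangle to the half-plane of the
first one. -/
def IsShearBend (z w ζ ζ' : Bdry) (x : ℂ) : Prop :=
  ∃ s s' α : ℝ, ∃ A : SL2C,
    IsProjection z w ζ s ∧ IsProjection z w ζ' s' ∧
    IsRotation z w α A ∧ act A '' halfPlane z w ζ' = halfPlane z w ζ ∧
    x = Complex.exp (((s' - s : ℝ) : ℂ) + ((Real.pi - α : ℝ) : ℂ) * Complex.I)

/-! ### Enhanced homomorphisms and pleated surfaces -/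

section Pleated

variable {X : Type*} [TopologicalSpace X] [ChartedSpace ℂ X] {V : Finset X}
  {E : Type*} [TopologicalSpace E]

/-- An enhanced homomorphism from the fundamental group to the group of orientation-preserving
isometries of hyperbolic 3-space; `ξ` is only relevant on peripheral subgroups. -/
structure EnhancedHom (p : E → Punctured V) where
  r : Deck p →* PSL2C
  ξ : Subgroup (Deck p) → Bdry
  fixed : ∀ π ∈ peripheralSubgroups p, ∀ γ ∈ π, r γ • ξ π = ξ π
  equivariant : ∀ π ∈ peripheralSubgroups p, ∀ γ : Deck p,
    ξ (π.map (MulAut.conj γ).toMonoidHom) = r γ • ξ π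

/-- A lift to the covering of a face with vertices deleted. When the covering is universal, the
images of these lifts are the closures of the components of the complement of the lifted edges. -/
structure LiftedFace (lam : IdealTriangulation V) (p : E → Punctured V) where
  face : lam.Face
  map : OpenTri → E
  continuous_map : Continuous map
  lifts : ∀ x, (p (map x)).1 = lam.char face x.1

variable {lam : IdealTriangulation V} {p : E → Punctured V}

/-- The lifted face `T'` is on the other side of the `i`-th side of the lifted face `T`, and this side
is the `i'`-th side of `T'`. -/
def LiftedFace.Adjacent (T : LiftedFace lam p) (i : Fin 3) (T' : LiftedFace lam p) (i' : Fin 3) :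
    Prop :=
  lam.mate (T.face, i) = (T'.face, i') ∧
    ∀ (x x' : OpenTri) (s : I), x.1 = Tri.side i s → x'.1 = Tri.side i' (σ s) → T.map x = T'.map x'

/-- `f` sends the lifted face `T` homeomorphically to the ideal triangle with vertices
`z 0, z 1, z 2`, respecting the sides and the vertices. -/
structure IsIdealImage (f : E → H3) (T : LiftedFace lam p) (z : Fin 3 → Bdry) : Prop where
  injective : Function.Injective z
  isEmbedding : IsEmbedding fun x => f (T.map x)
  range_eq : (range fun x => f (T.map x)) = idealTriangle z
  side_eq : ∀ i : Fin 3,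
    (fun x => f (T.map x)) '' {x | ∃ s, x.1 = Tri.side i s} = geodesic (z i) (z (i + 1))
  tendsto : ∀ a, TendsToIdeal (fun x => f (T.map x)) (OpenTri.nhdsVertex a) (z a)

variable (lam)

/-- `(f, r)` is a pleated surface, pleated along the ideal triangulation `lam`. -/
structure IsPleatedSurface (r : Deck p →* PSL2C) (f : E → H3) : Prop where
  continuous : Continuous f
  pleated : ∀ T : LiftedFace lam p, ∃ z, IsIdealImage f T z
  equivariant : ∀ (γ : Deck p) (A : SL2C), (QuotientGroup.mk A : PSL2C) = r γ →
    ∀ y, f (γ.1 y) = act A (f y)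

/-- The enhanced homomorphism `R` is associated to the pleated surface `(f, R.r)`: when `γ` is the
loop going around an ideal vertex of a lifted face, the point `ξ_π` associated to the peripheral
subgroup `π` generated by `γ` is the corresponding vertex of the image ideal triangle. -/
def IsAssociated (R : EnhancedHom p) (f : E → H3) : Prop :=
  IsPleatedSurface lam R.r f ∧
    ∀ (T : LiftedFace lam p) (z : Fin 3 → Bdry), IsIdealImage f T z → ∀ (a : Fin 3) (γ : Deck p),
      (∀ᶠ x in OpenTri.nhdsVertex a,
        IsPunctureLoopAt p (lam.vertexAt (T.face, a)) (T.map x) γ) →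
      R.ξ (Subgroup.zpowers γ) = z a

/-- `x` is the exponential shear-bend parameter of the pleated surface `f` along the edge `e`,
computed by lifting this edge, and the faces adjacent to it, to the covering. -/
def IsShearBendParameter (p : E → Punctured V) (f : E → H3) (e : lam.Edge) (x : ℂ) : Prop :=
  ∃ (T T' : LiftedFace lam p) (i i' : Fin 3) (z z' : Fin 3 → Bdry),
    lam.edge (T.face, i) = e ∧ T.Adjacent i T' i' ∧ IsIdealImage f T z ∧ IsIdealImage f T' z' ∧
    IsShearBend (z i) (z (i + 1)) (z (i + 2)) (z' (i' + 2)) x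

/-- The enhanced homomorphism `R` realizes the ideal triangulation `lam`, with edge weights
`x`: it is associated to a pleated surface with exponential shear-bend parameters `x`. -/
def HasEdgeWeights (R : EnhancedHom p) (x : lam.Edge → ℂ) : Prop :=
  ∃ f : E → H3, IsAssociated lam R f ∧ ∀ e, IsShearBendParameter lam p f e (x e)

/-- `R` realizes `lam`, and `h` is its total peripheral load `x₁ ⋯ xₙ`, computed from the edge
weights that it defines on `lam`. -/
def HasTotalPeripheralLoad (R : EnhancedHom p) (h : ℂ) : Prop :=
  ∃ x : lam.Edge → ℂ, HasEdgeWeights lam R x ∧ h = ∏ e, x e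

end Pleated

end PeripheralLoad

end

noncomputable section

namespace PeripheralLoad

/-! ### Spaces modelled on convex sets -/

/-! Fix a lift `rhat` of `r`, and choose vectors of ℂ² spanning the ideal vertices of all lifted
faces, equivariantly under `rhat`. Two adjacent lifted faces share two ideal vertices, where their
vectors differ by factors `m` which, by equivariance, depend only on the side of the triangulation
that is crossed.

An edge weight is minus a cross-ratio of four ideal points (`IsShearBend.eq_cross_ratio`), hence a
quotient of determinants of the chosen vectors. Once the vectors of the second face are compared
with those of the first, it becomes `-(y d * y (mate d))`, where `y d` is `m d` times a quotient of
two determinants attached to the face of `d`. In the product over all sides these quotients cancel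
(`prod_area_ratio`), and the product of the `n` edge weights is `(-1)^n ∏ m`.

Now group the sides by the vertices at which they end. Turning once counterclockwise around a
puncture leads from a lifted face `T` to `γ • T` (`exists_chain_around_puncture`). Along the way the
vector at the common ideal vertex `ξ` is multiplied by the corresponding factors `m`; by
equivariance it is also multiplied by `rhat γ`, that is, by the eigenvalue. So `∏ m` is the product
of the eigenvalues. Finally `(-1)^n = (-1)^p`, by comparing the signs of two permutations of the
corners (`neg_one_pow_card_edge`).

The resulting formula does not involve the triangulation, so independence only requires that some
lift `rhat` exists (`exists_lift_of_hom`). The covering is tiled by triangles without vertices, so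
the only obstruction is a sign for each crossing of a side, and such cocycles are coboundaries
because `E` is simply connected (`LiftedFace.exists_int_primitive`). -/

theorem contractibleSpace_of_isEmbedding_convex {A F : Type*} [TopologicalSpace A] [Nonempty A]
    [NormedAddCommGroup F] [NormedSpace ℝ F] {j : A → F} (hj : IsEmbedding j)
    (hc : Convex ℝ (range j)) : ContractibleSpace A :=
  have := hc.contractibleSpace (range_nonempty j)
  hj.toHomeomorph.contractibleSpace

theorem locallyPathConnectedSpace_of_isEmbedding_convex {A F : Type*} [TopologicalSpace A]
    [NormedAddCommGroup F] [NormedSpace ℝ F] {j : A → F} (hj : IsEmbedding j)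
    (hc : Convex ℝ (range j)) : LocallyPathConnectedSpace A := by
  refine LocallyPathConnectedSpace.of_bases (p := fun _ (ρ : ℝ) => 0 < ρ)
    (s := fun x ρ => j ⁻¹' Metric.ball (j x) ρ) (fun x => ?_) (fun x ρ hρ => ?_)
  · rw [hj.isInducing.nhds_eq_comap]
    exact Metric.nhds_basis_ball.comap j
  · rw [hj.isInducing.isPathConnected_iff, image_preimage_eq_inter_range]
    exact ((convex_ball _ _).inter hc).isPathConnected ⟨j x, Metric.mem_ball_self hρ, x, rfl⟩

/-! ### Barycentric coordinates -/

theorem Tri.nonneg (x : Tri) (a : Fin 3) : 0 ≤ x.1 a := x.2.1 a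

theorem Tri.sum_eq (x : Tri) (a : Fin 3) : x.1 a + x.1 (a + 1) + x.1 (a + 2) = 1 := by
  have h := x.2.2
  rw [Fin.sum_univ_three] at h
  fin_cases a <;> simp <;> linarith

theorem Tri.le_one (x : Tri) (a : Fin 3) : x.1 a ≤ 1 := by
  have := x.sum_eq a
  have := x.nonneg (a + 1)
  have := x.nonneg (a + 2)
  linarith

theorem Tri.ext_of {x y : Tri} (a : Fin 3) (h₁ : x.1 (a + 1) = y.1 (a + 1))
    (h₂ : x.1 (a + 2) = y.1 (a + 2)) : x = y := by
  have hx := x.sum_eq a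
  have hy := y.sum_eq a
  have h₀ : x.1 a = y.1 a := by linarith
  refine Subtype.ext (funext fun b => ?_)
  fin_cases a <;> fin_cases b <;> assumption

@[simp] theorem Tri.mix_apply (s : I) (x y : Tri) (b : Fin 3) :
    (Tri.mix s x y).1 b = (1 - (s : ℝ)) * x.1 b + s * y.1 b := rfl

@[simp] theorem Tri.vertex_self (a : Fin 3) : (Tri.vertex a).1 a = 1 := by
  simp

theorem Tri.vertex_ne {a b : Fin 3} (h : b ≠ a) : (Tri.vertex a).1 b = 0 := by
  simp [h]

@[simp] theorem Tri.vertex_add_one (a : Fin 3) : (Tri.vertex a).1 (a + 1) = 0 :=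
  Tri.vertex_ne (by simp)

@[simp] theorem Tri.vertex_add_two (a : Fin 3) : (Tri.vertex a).1 (a + 2) = 0 :=
  Tri.vertex_ne (by simp)

@[simp] theorem Tri.vertex_succ (a : Fin 3) : (Tri.vertex (a + 1)).1 a = 0 :=
  Tri.vertex_ne (by simp)

@[simp] theorem Tri.vertex_succ_add_two (a : Fin 3) : (Tri.vertex (a + 1)).1 (a + 2) = 0 :=
  Tri.vertex_ne (by simp)

@[simp] theorem Tri.vertex_pred (a : Fin 3) : (Tri.vertex (a + 2)).1 a = 0 :=
  Tri.vertex_ne (by simp)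

@[simp] theorem Tri.vertex_pred_add_one (a : Fin 3) : (Tri.vertex (a + 2)).1 (a + 1) = 0 :=
  Tri.vertex_ne (by simp)

theorem Tri.vertex_inj {a b : Fin 3} (h : Tri.vertex a = Tri.vertex b) : a = b := by
  by_contra hab
  have h1 := Tri.vertex_self a
  rw [h, Tri.vertex_ne hab] at h1
  exact zero_ne_one h1

theorem Tri.eq_vertex {x : Tri} {a : Fin 3} (h : x.1 a = 1) : x = Tri.vertex a := by
  have := x.sum_eq a
  have := x.nonneg (a + 1)
  have := x.nonneg (a + 2)
  refine Tri.ext_of a ?_ ?_ <;> simp <;> linarith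

@[simp] theorem Tri.side_apply (i : Fin 3) (s : I) : (Tri.side i s).1 i = 1 - (s : ℝ) := by
  simp [Tri.side]

@[simp] theorem Tri.side_add_one (i : Fin 3) (s : I) : (Tri.side i s).1 (i + 1) = s := by
  simp [Tri.side]

@[simp] theorem Tri.side_add_two (i : Fin 3) (s : I) : (Tri.side i s).1 (i + 2) = 0 := by
  simp [Tri.side]

theorem Tri.side_zero (i : Fin 3) : Tri.side i 0 = Tri.vertex i := Tri.eq_vertex (by simp)

theorem Tri.side_one (i : Fin 3) : Tri.side i 1 = Tri.vertex (i + 1) := Tri.eq_vertex (by simp)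

@[simp] theorem Tri.link_apply (a : Fin 3) (ε s : I) : (Tri.link a ε s).1 a = 1 - (ε : ℝ) := by
  simp [Tri.link]

theorem Tri.link_zero (a : Fin 3) (ε : I) : Tri.link a ε 0 = Tri.side a ε := by
  refine Tri.ext_of a ?_ ?_ <;> simp [Tri.link]

theorem Tri.link_one (a : Fin 3) (ε : I) : Tri.link a ε 1 = Tri.side (a + 2) (σ ε) := by
  have h1 : a + 2 + 1 = a := by rw [add_assoc]; simp
  refine Tri.ext_of a ?_ ?_
  · have := Tri.side_add_two (a + 2) (σ ε)
    rw [show a + 2 + 2 = a + 1 by rw [add_assoc]; rfl] at this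
    rw [this]
    simp [Tri.link]
  · simp [Tri.link]

@[fun_prop] theorem Tri.continuous_side (i : Fin 3) : Continuous (Tri.side i) := by
  unfold Tri.side Tri.mix
  fun_prop

@[fun_prop] theorem Tri.continuous_link (a : Fin 3) (ε : I) : Continuous (Tri.link a ε) := by
  unfold Tri.link Tri.mix
  fun_prop

@[fun_prop] theorem Tri.continuous_coord (b : Fin 3) : Continuous fun x : Tri => x.1 b :=
  (continuous_apply b).comp continuous_subtype_val

/-- One coordinate controls the distance to the vertex: the other two are nonnegative, and their sum
is its difference from 1. -/
theorem Tri.exists_forall_mem {a : Fin 3} {U : Set Tri} (hU : U ∈ 𝓝 (Tri.vertex a)) :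
    ∃ δ : ℝ, 0 < δ ∧ ∀ x : Tri, 1 - δ < x.1 a → x ∈ U := by
  obtain ⟨δ, hδ, h⟩ := Metric.mem_nhds_iff.1 hU
  refine ⟨δ, hδ, fun x hx => h ?_⟩
  rw [Metric.mem_ball, Subtype.dist_eq, dist_pi_lt_iff hδ]
  intro b
  have h0 := x.sum_eq a
  have h1 := x.nonneg (a + 1)
  have h2 := x.nonneg (a + 2)
  have key : b = a ∨ b = a + 1 ∨ b = a + 2 := by
    fin_cases a <;> fin_cases b <;> simp
  rw [Real.dist_eq, abs_lt]
  rcases key with rfl | rfl | rfl <;> simp <;> constructor <;> linarith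

/-! ### The triangle with vertices deleted -/

theorem OpenTri.coord_lt_one (x : OpenTri) (a : Fin 3) : x.1.1 a < 1 :=
  lt_of_le_of_ne (x.1.le_one a) fun h => x.2 a (Tri.eq_vertex h)

theorem OpenTri.isEmbedding_coe : IsEmbedding fun x : OpenTri => x.1.1 :=
  IsEmbedding.subtypeVal.comp IsEmbedding.subtypeVal

theorem OpenTri.range_coe : range (fun x : OpenTri => x.1.1) =
    stdSimplex ℝ (Fin 3) ∩ {x | ∀ a, x a < 1} := by
  ext x
  constructor
  · rintro ⟨x, rfl⟩
    exact ⟨x.1.2, fun a => x.coord_lt_one a⟩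
  · rintro ⟨h, h'⟩
    exact ⟨⟨⟨x, h⟩, fun a ha => (h' a).ne (by
      have h1 := Tri.vertex_self a
      rwa [← ha] at h1)⟩, rfl⟩

theorem OpenTri.convex_range : Convex ℝ (range fun x : OpenTri => x.1.1) := by
  rw [OpenTri.range_coe]
  refine (convex_stdSimplex ℝ (Fin 3)).inter ?_
  rw [ofPred_forall]
  exact convex_iInter fun a => convex_halfSpace_lt (LinearMap.proj (R := ℝ) a).isLinear 1

/-- The points of the triangle with vertices deleted whose `a`-th coordinate is more
than `1 - δ`. -/
def OpenTri.corner (a : Fin 3) (δ : ℝ) : Set OpenTri := {x | 1 - δ < x.1.1 a}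

theorem OpenTri.corner_mem (a : Fin 3) {δ : ℝ} (hδ : 0 < δ) :
    OpenTri.corner a δ ∈ OpenTri.nhdsVertex a := by
  refine ⟨{x | 1 - δ < x.1 a}, ?_, fun x hx => hx⟩
  exact (Tri.continuous_coord a).continuousAt.eventually (lt_mem_nhds (by simpa))

theorem OpenTri.convex_corner (a : Fin 3) (δ : ℝ) :
    Convex ℝ (range fun x : OpenTri.corner a δ => x.1.1.1) := by
  have : range (fun x : OpenTri.corner a δ => x.1.1.1) =
      range (fun x : OpenTri => x.1.1) ∩ {x | 1 - δ < x a} := by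
    ext x
    constructor
    · rintro ⟨x, rfl⟩
      exact ⟨⟨x.1, rfl⟩, x.2⟩
    · rintro ⟨⟨x, rfl⟩, h⟩
      exact ⟨⟨x, h⟩, rfl⟩
  rw [this]
  exact OpenTri.convex_range.inter
    (convex_halfSpace_gt (LinearMap.proj (R := ℝ) a).isLinear _)

/-- The point of the link of the vertex `a`, as a point of the triangle with vertices deleted. -/
def OpenTri.link (a : Fin 3) (ε : I) (hε : (ε : ℝ) ∈ Ioo (0 : ℝ) 1) (s : I) : OpenTri :=
  ⟨Tri.link a ε s, fun b hb => by
    have h := Tri.link_apply a ε s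
    rw [hb] at h
    obtain ⟨h0, h1⟩ := hε
    by_cases hab : a = b
    · subst hab
      simp at h
      linarith
    · rw [Tri.vertex_ne hab] at h
      linarith⟩

theorem OpenTri.continuous_link (a : Fin 3) (ε : I) (hε : (ε : ℝ) ∈ Ioo (0 : ℝ) 1) :
    Continuous (OpenTri.link a ε hε) :=
  (Tri.continuous_link a ε).subtype_mk _

theorem OpenTri.link_mem_corner (a : Fin 3) (ε : I) (hε : (ε : ℝ) ∈ Ioo (0 : ℝ) 1) (s : I)
    {δ : ℝ} (h : (ε : ℝ) < δ) : OpenTri.link a ε hε s ∈ OpenTri.corner a δ := by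
  simp only [OpenTri.corner, OpenTri.link, mem_ofPred_eq, Tri.link_apply]
  linarith

/-- The point of the open `i`-th side, as a point of the triangle with vertices deleted. -/
def OpenTri.side (i : Fin 3) (s : Ioo (0 : ℝ) 1) : OpenTri :=
  ⟨Tri.side i ⟨s, Ioo_subset_Icc_self s.2⟩, fun b hb => by
    obtain ⟨s, h0, h1⟩ := s
    have e0 := Tri.side_apply i ⟨s, h0.le, h1.le⟩
    have e1 := Tri.side_add_one i ⟨s, h0.le, h1.le⟩
    have e2 := Tri.side_add_two i ⟨s, h0.le, h1.le⟩
    rw [hb] at e0 e1 e2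
    have key : i = b ∨ i + 1 = b ∨ i + 2 = b := by
      fin_cases i <;> fin_cases b <;> simp
    rcases key with rfl | rfl | rfl <;> simp at e0 e1 e2 <;> linarith⟩

@[fun_prop] theorem OpenTri.continuous_side (i : Fin 3) : Continuous (OpenTri.side i) := by
  unfold OpenTri.side
  fun_prop

theorem OpenTri.mem_Ioo_of_eq_side {x : OpenTri} {i : Fin 3} {s : I} (h : x.1 = Tri.side i s) :
    (s : ℝ) ∈ Ioo (0 : ℝ) 1 := by
  have h0 := x.coord_lt_one i
  have h1 := x.coord_lt_one (i + 1)
  rw [h] at h0 h1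
  simp at h0 h1
  exact ⟨h0, h1⟩

instance : Nonempty OpenTri := ⟨OpenTri.side 0 ⟨1 / 2, by norm_num⟩⟩

instance : ContractibleSpace OpenTri :=
  contractibleSpace_of_isEmbedding_convex OpenTri.isEmbedding_coe OpenTri.convex_range

instance : LocallyPathConnectedSpace OpenTri :=
  locallyPathConnectedSpace_of_isEmbedding_convex OpenTri.isEmbedding_coe OpenTri.convex_range

theorem OpenTri.corner_nonempty (a : Fin 3) {δ : ℝ} (hδ : 0 < δ) :
    (OpenTri.corner a δ).Nonempty := by
  set ε : ℝ := min (δ / 2) (1 / 2)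
  have h0 : 0 < ε := lt_min (by linarith) (by norm_num)
  have h1 : ε ≤ 1 / 2 := min_le_right _ _
  have h2 : ε ≤ δ / 2 := min_le_left _ _
  exact ⟨_, OpenTri.link_mem_corner a ⟨ε, h0.le, by linarith⟩ ⟨h0, by simp; linarith⟩ 0
    (by simp; linarith)⟩

theorem OpenTri.contractibleSpace_corner (a : Fin 3) {δ : ℝ} (hδ : 0 < δ) :
    ContractibleSpace (OpenTri.corner a δ) :=
  have := (OpenTri.corner_nonempty a hδ).to_subtype
  contractibleSpace_of_isEmbedding_convex (OpenTri.isEmbedding_coe.comp IsEmbedding.subtypeVal)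
    (OpenTri.convex_corner a δ)

theorem OpenTri.locallyPathConnectedSpace_corner (a : Fin 3) (δ : ℝ) :
    LocallyPathConnectedSpace (OpenTri.corner a δ) :=
  locallyPathConnectedSpace_of_isEmbedding_convex
    (OpenTri.isEmbedding_coe.comp IsEmbedding.subtypeVal) (OpenTri.convex_corner a δ)

theorem OpenTri.exists_corner_subset {a : Fin 3} {s : Set OpenTri}
    (hs : s ∈ OpenTri.nhdsVertex a) : ∃ δ : ℝ, 0 < δ ∧ OpenTri.corner a δ ⊆ s := by
  obtain ⟨U, hU, h⟩ := hs
  obtain ⟨δ, hδ, h'⟩ := Tri.exists_forall_mem hU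
  exact ⟨δ, hδ, fun x hx => h (h' _ hx)⟩

instance (a : Fin 3) : (OpenTri.nhdsVertex a).NeBot := by
  rw [← forall_mem_nonempty_iff_neBot]
  intro s hs
  obtain ⟨δ, hδ, h⟩ := OpenTri.exists_corner_subset hs
  exact (OpenTri.corner_nonempty a hδ).mono h

/-- This limit and the next use the same filter of parameters, so that the ends of two glued sides,
travelled in opposite directions, can be compared. -/
theorem OpenTri.tendsto_side_zero (i : Fin 3) :
    Tendsto (OpenTri.side i) (comap Subtype.val (𝓝[>] (0 : ℝ))) (OpenTri.nhdsVertex i) := by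
  refine tendsto_comap_iff.2 ?_
  have h : Tendsto (fun s : ℝ => Tri.side i (projIcc 0 1 zero_le_one s)) (𝓝[>] 0)
      (𝓝 (Tri.vertex i)) := by
    have hc : Continuous fun s : ℝ => Tri.side i (projIcc 0 1 zero_le_one s) :=
      (Tri.continuous_side i).comp continuous_projIcc
    have := hc.tendsto 0
    rw [projIcc_left] at this
    rw [← Tri.side_zero i]
    exact this.mono_left nhdsWithin_le_nhds
  refine (h.comp tendsto_comap).congr fun s => ?_
  simp only [Function.comp, OpenTri.side]
  rw [projIcc_of_mem zero_le_one (Ioo_subset_Icc_self s.2)]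

theorem OpenTri.tendsto_side_one (i : Fin 3) :
    Tendsto (fun s : Ioo (0 : ℝ) 1 => OpenTri.side i ⟨1 - s, by
      have := s.2; constructor <;> linarith [this.1, this.2]⟩)
      (comap Subtype.val (𝓝[>] (0 : ℝ))) (OpenTri.nhdsVertex (i + 1)) := by
  refine tendsto_comap_iff.2 ?_
  have h : Tendsto (fun s : ℝ => Tri.side i (projIcc 0 1 zero_le_one (1 - s))) (𝓝[>] 0)
      (𝓝 (Tri.vertex (i + 1))) := by
    have hc : Continuous fun s : ℝ => Tri.side i (projIcc 0 1 zero_le_one (1 - s)) :=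
      (Tri.continuous_side i).comp (continuous_projIcc.comp (by fun_prop))
    have := hc.tendsto 0
    rw [sub_zero, projIcc_right] at this
    rw [← Tri.side_one i]
    exact this.mono_left nhdsWithin_le_nhds
  refine (h.comp tendsto_comap).congr fun s => ?_
  simp only [Function.comp, OpenTri.side]
  rw [projIcc_of_mem zero_le_one]

instance : (comap (Subtype.val : Ioo (0 : ℝ) 1 → ℝ) (𝓝[>] (0 : ℝ))).NeBot := by
  refine comap_neBot fun t ht => ?_
  obtain ⟨x, hx, hx'⟩ :=
    Filter.nonempty_of_mem (inter_mem (Ioo_mem_nhdsGT (zero_lt_one (α := ℝ))) ht)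
  exact ⟨⟨x, hx⟩, hx'⟩

section Hyperbolic

open Matrix

/-! ### Lines in the plane -/

/-- The determinant of two vectors of the plane. -/
def area (u v : Fin 2 → ℂ) : ℂ := u 0 * v 1 - u 1 * v 0

@[simp] theorem area_smul_left (c : ℂ) (u v : Fin 2 → ℂ) : area (c • u) v = c * area u v := by
  simp [area]; ring

@[simp] theorem area_smul_right (c : ℂ) (u v : Fin 2 → ℂ) : area u (c • v) = c * area u v := by
  simp [area]; ring

theorem area_swap (u v : Fin 2 → ℂ) : area v u = -area u v := by simp [area]; ring

theorem area_self (u : Fin 2 → ℂ) : area u u = 0 := by simp [area]; ring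

theorem SL2C.smul_eq (A : SL2C) (u : Fin 2 → ℂ) : A • u = A.1 *ᵥ u := rfl

theorem area_smul_smul (A : SL2C) (u v : Fin 2 → ℂ) : area (A • u) (A • v) = area u v := by
  have h := A.2
  rw [det_fin_two] at h
  simp only [area, SL2C.smul_eq, mulVec, dotProduct, Fin.sum_univ_two]
  linear_combination (u 0 * v 1 - u 1 * v 0) * h

/-- The nonzero vector `u` spans the line `z`. -/
def Spans (u : Fin 2 → ℂ) (z : Bdry) : Prop := u ≠ 0 ∧ u ∈ z.submodule

theorem spans_mk_iff {u v : Fin 2 → ℂ} (hv : v ≠ 0) :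
    Spans u (Projectivization.mk ℂ v hv) ↔ ∃ c : ℂ, c ≠ 0 ∧ u = c • v := by
  simp only [Spans, Projectivization.submodule_mk, Submodule.mem_span_singleton]
  constructor
  · rintro ⟨h, c, rfl⟩
    exact ⟨c, fun hc => h (by simp [hc]), rfl⟩
  · rintro ⟨c, hc, rfl⟩
    exact ⟨smul_ne_zero hc hv, c, rfl⟩

theorem spans_rep (z : Bdry) : Spans z.rep z := by
  refine ⟨z.rep_nonzero, ?_⟩
  rw [Projectivization.submodule_eq]
  exact Submodule.mem_span_singleton_self _

theorem Spans.mk_eq {u : Fin 2 → ℂ} {z : Bdry} (h : Spans u z) :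
    z = Projectivization.mk ℂ u h.1 := by
  induction z using Projectivization.ind with | _ v hv =>
  obtain ⟨c, hc, rfl⟩ := (spans_mk_iff hv).1 h
  rw [Projectivization.mk_eq_mk_iff']
  exact ⟨c⁻¹, by rw [smul_smul, inv_mul_cancel₀ hc, one_smul]⟩

theorem Spans.exists_eq_smul {u v : Fin 2 → ℂ} {z : Bdry} (hu : Spans u z) (hv : Spans v z) :
    ∃ c : ℂ, c ≠ 0 ∧ u = c • v := by
  rw [hv.mk_eq] at hu
  exact (spans_mk_iff hv.1).1 hu

theorem SL2C.smul_ne_zero (A : SL2C) {u : Fin 2 → ℂ} (hu : u ≠ 0) : A • u ≠ 0 :=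
  (smul_ne_zero_iff_ne A).2 hu

theorem Spans.smul (A : SL2C) {u : Fin 2 → ℂ} {z : Bdry} (h : Spans u z) :
    Spans (A • u) (A • z) := by
  rw [h.mk_eq, Projectivization.smul_mk, spans_mk_iff]
  exact ⟨1, one_ne_zero, (one_smul _ _).symm⟩

theorem Spans.area_ne_zero {u v : Fin 2 → ℂ} {z w : Bdry} (hu : Spans u z) (hv : Spans v w)
    (h : z ≠ w) : area u v ≠ 0 := by
  intro h0
  refine h ?_
  rw [hu.mk_eq, hv.mk_eq, Projectivization.mk_eq_mk_iff']
  simp only [area] at h0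
  by_cases h1 : v 0 = 0
  · have h2 : v 1 ≠ 0 := fun h2 => hv.1 (by ext i; fin_cases i <;> simpa)
    refine ⟨u 1 / v 1, ?_⟩
    ext i
    fin_cases i
    · simp only [h1, mul_zero, sub_zero, mul_eq_zero, h2, or_false] at h0
      simp [h0, h1]
    · simp [h2]
  · refine ⟨u 0 / v 0, ?_⟩
    ext i
    fin_cases i
    · simp [h1]
    · simp only [Pi.smul_apply, smul_eq_mul, Fin.mk_one]
      field_simp
      linear_combination h0

/-! ### Rank one hermitian matrices -/

/-- The matrix `u u*`. -/
def rankOne (u : Fin 2 → ℂ) : Matrix (Fin 2) (Fin 2) ℂ := vecMulVec u (star u)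

/-- The square of the norm of a vector. -/
def normSq (u : Fin 2 → ℂ) : ℝ := ‖u 0‖ ^ 2 + ‖u 1‖ ^ 2

theorem normSq_pos {u : Fin 2 → ℂ} (h : u ≠ 0) : 0 < normSq u := by
  unfold normSq
  by_cases h0 : u 0 = 0
  · have h1 : u 1 ≠ 0 := fun h1 => h (by ext i; fin_cases i <;> simpa)
    have := norm_pos_iff.2 h1
    positivity
  · have := norm_pos_iff.2 h0
    positivity

theorem trace_rankOne (u : Fin 2 → ℂ) : (rankOne u).trace = normSq u := by
  simp [rankOne, normSq, Complex.mul_conj, Complex.normSq_eq_norm_sq]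

theorem rankOne_smul (c : ℂ) (u : Fin 2 → ℂ) : rankOne (c • u) = ((‖c‖ ^ 2 : ℝ) : ℂ) • rankOne u := by
  ext i j
  simp only [rankOne, vecMulVec_apply, Pi.smul_apply, Pi.star_apply, smul_eq_mul, star_mul',
    Matrix.smul_apply, ← Complex.normSq_eq_norm_sq, Complex.normSq_eq_conj_mul_self]
  simp only [Complex.star_def]
  ring

theorem conj_rankOne (A : SL2C) (u : Fin 2 → ℂ) : A.1 * rankOne u * A.1ᴴ = rankOne (A • u) := by
  rw [rankOne, mul_vecMulVec, vecMulVec_mul, rankOne, SL2C.smul_eq, star_mulVec]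

/-- Rescaling `u` multiplies `u u*` by a positive real number, which the normalization of the trace
removes. -/
theorem null_eq_of_spans {u : Fin 2 → ℂ} {z : Bdry} (h : Spans u z) :
    null z = (((normSq u)⁻¹ : ℝ) : ℂ) • rankOne u := by
  have hn : ∀ v : Fin 2 → ℂ, star v ⬝ᵥ v = (normSq v : ℂ) := fun v => by
    rw [← trace_rankOne, rankOne, trace_vecMulVec, dotProduct_comm]
  obtain ⟨c, hc, h'⟩ := h.exists_eq_smul (spans_rep z)
  have hr := (normSq_pos z.rep_nonzero).ne'
  have h1 : normSq u = ‖c‖ ^ 2 * normSq z.rep := by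
    rw [h']
    simp [normSq, mul_pow, mul_add]
  have h2 : ‖c‖ ≠ 0 := norm_ne_zero_iff.2 hc
  rw [null, hn, h1, h', rankOne_smul, smul_smul, ← Complex.ofReal_mul, ← rankOne,
    ← Complex.ofReal_inv]
  congr 2
  field_simp

theorem lorentz_rankOne (u v : Fin 2 → ℂ) :
    lorentz (rankOne u) (rankOne v) = ((‖area u v‖ ^ 2 / 2 : ℝ) : ℂ) := by
  simp only [← Complex.normSq_eq_norm_sq, Complex.ofReal_div, Complex.normSq_eq_conj_mul_self]
  simp [lorentz, rankOne, trace_fin_two, vecMulVec_apply, area, mul_apply, Fin.sum_univ_two]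
  ring

theorem lorentz_smul_smul (a b : ℂ) (P Q : Matrix (Fin 2) (Fin 2) ℂ) :
    lorentz (a • P) (b • Q) = a * b * lorentz P Q := by
  simp [lorentz]
  ring

theorem lorentz_null {u v : Fin 2 → ℂ} {z w : Bdry} (hu : Spans u z) (hv : Spans v w) :
    lorentz (null z) (null w) =
      ((‖area u v‖ ^ 2 / (2 * normSq u * normSq v) : ℝ) : ℂ) := by
  have := (normSq_pos hu.1).ne'
  have := (normSq_pos hv.1).ne'
  rw [null_eq_of_spans hu, null_eq_of_spans hv, lorentz_smul_smul, lorentz_rankOne,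
    ← Complex.ofReal_mul, ← Complex.ofReal_mul]
  congr 1
  field_simp

/-- Distinct isotropic lines have nonzero Lorentz product, while each one is orthogonal to itself.
-/
theorem null_injective : Function.Injective null := by
  intro z w h
  by_contra hzw
  have h1 := lorentz_null (spans_rep z) (spans_rep w)
  rw [← h, lorentz_null (spans_rep z) (spans_rep z), area_self, Complex.ofReal_inj] at h1
  have h2 := norm_pos_iff.2 ((spans_rep z).area_ne_zero (spans_rep w) hzw)
  have h3 := normSq_pos z.rep_nonzero
  have h4 := normSq_pos w.rep_nonzero
  have : 0 < ‖area z.rep w.rep‖ ^ 2 / (2 * normSq z.rep * normSq w.rep) := by positivity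
  rw [← h1] at this
  simp at this

/-! ### Convergence to ideal points -/

theorem TendsToIdeal.unique {α : Type*} {f : α → H3} {l : Filter α} [l.NeBot] {z w : Bdry}
    (hz : TendsToIdeal f l z) (hw : TendsToIdeal f l w) : z = w :=
  null_injective (tendsto_nhds_unique hz hw)

theorem trace_conj_null_ne_zero (A : SL2C) (z : Bdry) : (A.1 * null z * A.1ᴴ).trace ≠ 0 := by
  have h := spans_rep z
  have h1 := (normSq_pos h.1).ne'
  have h2 := (normSq_pos (SL2C.smul_ne_zero A h.1)).ne'
  rw [null_eq_of_spans h, Matrix.mul_smul, Matrix.smul_mul, conj_rankOne, trace_smul,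
    trace_rankOne, smul_eq_mul, ← Complex.ofReal_mul]
  exact_mod_cast mul_ne_zero (inv_ne_zero h1) h2

theorem null_smul (A : SL2C) (z : Bdry) :
    null (A • z) = (A.1 * null z * A.1ᴴ).trace⁻¹ • (A.1 * null z * A.1ᴴ) := by
  have h := spans_rep z
  have h1 := (normSq_pos h.1).ne'
  have h2 := (normSq_pos (SL2C.smul_ne_zero A h.1)).ne'
  rw [null_eq_of_spans (h.smul A), null_eq_of_spans h, Matrix.mul_smul, Matrix.smul_mul,
    conj_rankOne, trace_smul, trace_rankOne, smul_eq_mul, ← Complex.ofReal_mul, smul_smul,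
    ← Complex.ofReal_inv, ← Complex.ofReal_mul]
  congr 2
  field_simp

theorem klein_act (A : SL2C) (P : H3) :
    klein (act A P) = (A.1 * klein P * A.1ᴴ).trace⁻¹ • (A.1 * klein P * A.1ᴴ) := by
  have ht : P.1.trace ≠ 0 := P.2.1.trace_pos.ne'
  simp only [klein, act, Matrix.mul_smul, Matrix.smul_mul, trace_smul, smul_eq_mul, mul_inv,
    inv_inv, smul_smul]
  congr 1
  field_simp

/-- In the Klein model the action is `P ↦ A P A*` renormalized to trace 1; this stays continuous at
the boundary sphere because the trace does not vanish there. -/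
theorem TendsToIdeal.act {α : Type*} {f : α → H3} {l : Filter α} {z : Bdry}
    (hz : TendsToIdeal f l z) (A : SL2C) : TendsToIdeal (fun x => act A (f x)) l (A • z) := by
  unfold TendsToIdeal at *
  simp only [klein_act, null_smul]
  have h : Tendsto (fun x => A.1 * klein (f x) * A.1ᴴ) l (𝓝 (A.1 * null z * A.1ᴴ)) :=
    (((continuous_const.mul continuous_id).mul continuous_const).tendsto (null z)).comp hz
  exact (((continuous_id.matrix_trace.tendsto _).comp h).inv₀
    (trace_conj_null_ne_zero A z)).smul h

/-! ### The shear-bend parameter as a cross-ratio -/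

/-- Orthogonality equates `e^s` times the Lorentz product of `w` and `ζ` with `e^(-s)` times that of
`z` and `ζ`. The remaining factors `normSq u` and `normSq v` disappear when two projections are
compared. -/
theorem exp_of_isProjection {z w ζ : Bdry} {s : ℝ} {u v t : Fin 2 → ℂ} (hu : Spans u z)
    (hv : Spans v w) (ht : Spans t ζ) (hzw : z ≠ w) (h : IsProjection z w ζ s) :
    Real.exp s ^ 2 * (‖area v t‖ ^ 2 * normSq u) = ‖area u t‖ ^ 2 * normSq v := by
  have hu' := normSq_pos hu.1
  have hv' := normSq_pos hv.1
  have ht' := normSq_pos ht.1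
  have hA := norm_pos_iff.2 (hu.area_ne_zero hv hzw)
  unfold IsProjection geodesicVelocity at h
  set r := Real.sqrt (2 * (lorentz (null z) (null w)).re) with hr
  have hr0 : 0 < r := by
    rw [hr, lorentz_null hu hv, Complex.ofReal_re]
    positivity
  have h1 : lorentz (r⁻¹ • (Real.exp s • null w - Real.exp (-s) • null z)) (null ζ) =
      ((r⁻¹ : ℝ) : ℂ) * (Real.exp s * lorentz (null w) (null ζ) -
        Real.exp (-s) * lorentz (null z) (null ζ)) := by
    simp only [lorentz, trace_smul, trace_sub, Matrix.smul_mul, Matrix.sub_mul, Complex.real_smul]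
    ring
  rw [h1, lorentz_null hv ht, lorentz_null hu ht] at h
  have h2 := (mul_eq_zero.1 h).resolve_left (by exact_mod_cast (inv_pos.2 hr0).ne')
  norm_cast at h2
  rw [Real.exp_neg] at h2
  have := Real.exp_pos s
  field_simp at h2
  linarith

theorem posDef_of_sum_null {M : Matrix (Fin 2) (Fin 2) ℂ} (h : M.PosSemidef) (h' : M.det ≠ 0) :
    M.PosDef :=
  h.posDef_iff_isUnit.2 ((isUnit_iff_isUnit_det M).2 (isUnit_iff_ne_zero.2 h'))

theorem posSemidef_null (z : Bdry) : (null z).PosSemidef := by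
  rw [null_eq_of_spans (spans_rep z)]
  exact (posSemidef_vecMulVec_self_star _).smul
    (by exact_mod_cast (inv_pos.2 (normSq_pos z.rep_nonzero)).le)

theorem det_add_eq (P Q R : Matrix (Fin 2) (Fin 2) ℂ) (hP : P.det = 0) (hQ : Q.det = 0)
    (hR : R.det = 0) :
    (P + Q + R).det = 2 * (lorentz P Q + lorentz P R + lorentz Q R) := by
  rw [det_fin_two] at hP hQ hR
  simp only [lorentz, det_fin_two, trace_fin_two, mul_apply, Fin.sum_univ_two, Matrix.add_apply]
  linear_combination hP + hQ + hR

theorem det_null (z : Bdry) : (null z).det = 0 := by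
  rw [null, det_fin_two]
  simp [vecMulVec_apply]
  ring

/-- The sum of the three isotropic matrices is positive semidefinite, with positive determinant
since `z ≠ w`; a positive multiple of it has determinant 1. -/
theorem halfPlane_nonempty {z w ζ : Bdry} (h : z ≠ w) : (halfPlane z w ζ).Nonempty := by
  set M := null z + null w + null ζ with hM
  obtain ⟨D, hD, hMD⟩ : ∃ D : ℝ, 0 < D ∧ M.det = D := by
    have h1 := norm_pos_iff.2 ((spans_rep z).area_ne_zero (spans_rep w) h)
    have hz := normSq_pos z.rep_nonzero
    have hw := normSq_pos w.rep_nonzero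
    have hζ := normSq_pos ζ.rep_nonzero
    refine ⟨2 * (‖area z.rep w.rep‖ ^ 2 / (2 * normSq z.rep * normSq w.rep) +
      ‖area z.rep ζ.rep‖ ^ 2 / (2 * normSq z.rep * normSq ζ.rep) +
      ‖area w.rep ζ.rep‖ ^ 2 / (2 * normSq w.rep * normSq ζ.rep)), by positivity, ?_⟩
    · rw [hM, det_add_eq _ _ _ (det_null _) (det_null _) (det_null _),
        lorentz_null (spans_rep z) (spans_rep w), lorentz_null (spans_rep z) (spans_rep ζ),
        lorentz_null (spans_rep w) (spans_rep ζ)]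
      norm_cast
  have hs := Real.sqrt_pos.2 hD
  set c := (Real.sqrt D)⁻¹ with hc
  have hc0 : 0 < c := inv_pos.2 hs
  have hpos : M.PosDef := posDef_of_sum_null
    (((posSemidef_null z).add (posSemidef_null w)).add (posSemidef_null ζ))
    (by rw [hMD]; exact_mod_cast hD.ne')
  have hsm : c • M = (c : ℂ) • M := by ext; simp
  refine ⟨⟨c • M, ?_, ?_⟩, c, c, c, hc0, ?_⟩
  · rw [hsm]
    exact hpos.smul (by exact_mod_cast hc0)
  · rw [hsm, det_smul, hMD, Fintype.card_fin, ← Complex.ofReal_pow, ← Complex.ofReal_mul]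
    rw [hc, inv_pow, Real.sq_sqrt hD.le, inv_mul_cancel₀ hD.ne', Complex.ofReal_one]
  · simp [hM, smul_add]

/-- The coefficient of `u v*` of a hermitian form, in the basis `u, v`. -/
def crossTerm (u v : Fin 2 → ℂ) (P : Matrix (Fin 2) (Fin 2) ℂ) : ℂ :=
  ![v 1, -v 0] ⬝ᵥ (P *ᵥ ![star (u 1), -star (u 0)])

theorem crossTerm_add (u v : Fin 2 → ℂ) (P Q : Matrix (Fin 2) (Fin 2) ℂ) :
    crossTerm u v (P + Q) = crossTerm u v P + crossTerm u v Q := by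
  rw [crossTerm, add_mulVec, dotProduct_add, crossTerm, crossTerm]

theorem crossTerm_smul (u v : Fin 2 → ℂ) (c : ℂ) (P : Matrix (Fin 2) (Fin 2) ℂ) :
    crossTerm u v (c • P) = c * crossTerm u v P := by
  rw [crossTerm, smul_mulVec, dotProduct_smul, crossTerm, smul_eq_mul]

theorem crossTerm_real_smul (u v : Fin 2 → ℂ) (c : ℝ) (P : Matrix (Fin 2) (Fin 2) ℂ) :
    crossTerm u v (c • P) = c * crossTerm u v P := by
  rw [← crossTerm_smul]
  congr 1

theorem crossTerm_rankOne (u v t : Fin 2 → ℂ) :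
    crossTerm u v (rankOne t) = area v t * star (area u t) := by
  simp [crossTerm, rankOne, area, mulVec, dotProduct, Fin.sum_univ_two, vecMulVec_apply]
  ring

/-- `crossTerm u v` kills `u u*` and `v v*`, so it sends a half-plane bounded by the geodesic into
the ray through its value at the third ideal vertex. The rotation multiplies `u` and `v` by opposite
phases, hence turns this ray by `exp (-iα)`. -/
theorem IsRotation.crossTerm_eq {z w ζ ζ' : Bdry} {u v t t' : Fin 2 → ℂ} (hu : Spans u z)
    (hv : Spans v w) (ht : Spans t ζ) (ht' : Spans t' ζ') (hzw : z ≠ w) {α : ℝ} {A : SL2C}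
    (hA : IsRotation z w α A) (h : act A '' halfPlane z w ζ' = halfPlane z w ζ) :
    ∃ k : ℝ, 0 < k ∧ Complex.exp (-α * Complex.I) * (area v t' * star (area u t')) =
      k * (area v t * star (area u t)) := by
  obtain ⟨P, hP⟩ := halfPlane_nonempty (ζ := ζ') hzw
  obtain ⟨a', b', c', hc', hP'⟩ := h ▸ mem_image_of_mem (act A) hP
  obtain ⟨a, b, c, hc, hP⟩ := hP
  have e1 : A • v = Complex.exp (α / 2 * Complex.I) • v := hA.1 v hv.2
  have e0 : A • u = Complex.exp (-(α / 2) * Complex.I) • u := hA.2 u hu.2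
  have hmul : Complex.exp (-(α / 2) * Complex.I) * Complex.exp (α / 2 * Complex.I) = 1 := by
    rw [← Complex.exp_add]
    simp
  have hmul' : Complex.exp (-(α / 2) * Complex.I) * Complex.exp (-(α / 2) * Complex.I) =
      Complex.exp (-α * Complex.I) := by
    rw [← Complex.exp_add]
    ring_nf
  have hstar : star (Complex.exp (α / 2 * Complex.I)) = Complex.exp (-(α / 2) * Complex.I) := by
    rw [Complex.star_def, ← Complex.exp_conj]
    simp [map_ofNat]
  have f1 : area v (A • t') = Complex.exp (-(α / 2) * Complex.I) * area v t' := by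
    have := area_smul_smul A v t'
    rw [e1, area_smul_left] at this
    rw [← this, ← mul_assoc, hmul, one_mul]
  have f0 : area u (A • t') = Complex.exp (α / 2 * Complex.I) * area u t' := by
    have := area_smul_smul A u t'
    rw [e0, area_smul_left] at this
    rw [← this, ← mul_assoc, mul_comm (Complex.exp _), hmul, one_mul]
  -- The cross term of `act A P` is computed twice: in the half-plane of `ζ`, and by transporting
  -- the decomposition of `P`.
  have key : crossTerm u v (act A P).1 = crossTerm u v (a' • null z + b' • null w + c' • null ζ) := by
    rw [hP']
  have hact : (act A P).1 = a • (A.1 * null z * A.1ᴴ) + b • (A.1 * null w * A.1ᴴ) +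
      c • (A.1 * null ζ' * A.1ᴴ) := by
    simp only [act, hP, Matrix.mul_add, Matrix.add_mul, Matrix.mul_smul, Matrix.smul_mul]
  have z0 : ∀ c : ℂ, crossTerm u v (rankOne (c • u)) = 0 := fun c => by
    rw [crossTerm_rankOne, area_smul_right c u u, area_self]; simp
  have w0 : ∀ c : ℂ, crossTerm u v (rankOne (c • v)) = 0 := fun c => by
    rw [crossTerm_rankOne, area_smul_right c v v, area_self]; simp
  have z1 : crossTerm u v (rankOne u) = 0 := by simpa using z0 1
  have w1 : crossTerm u v (rankOne v) = 0 := by simpa using w0 1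
  rw [hact] at key
  simp only [crossTerm_add, crossTerm_real_smul, null_eq_of_spans hu, null_eq_of_spans hv,
    null_eq_of_spans ht, null_eq_of_spans ht', Matrix.mul_smul, Matrix.smul_mul, conj_rankOne,
    crossTerm_smul, e0, e1, z0, w0, z1, w1, mul_zero, zero_add, crossTerm_rankOne, f0, f1,
    star_mul', hstar] at key
  have n1 := normSq_pos ht.1
  have n2 := normSq_pos ht'.1
  refine ⟨c'  / c * (normSq t' / normSq t), by positivity, ?_⟩
  rw [← hmul']
  have hcC : (c : ℂ) ≠ 0 := by exact_mod_cast hc.ne'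
  have n1C : (normSq t : ℂ) ≠ 0 := by exact_mod_cast n1.ne'
  have n2C : (normSq t' : ℂ) ≠ 0 := by exact_mod_cast n2.ne'
  push_cast at key ⊢
  field_simp at key ⊢
  linear_combination key

/-- The two projections give the modulus of the cross-ratio, the rotation gives its argument, and
the minus sign is `exp (iπ)`. For `z = 0` and `w = ∞` this is `-ζ'/ζ`. -/
theorem IsShearBend.eq_cross_ratio {z w ζ ζ' : Bdry} {u v t t' : Fin 2 → ℂ} (hu : Spans u z)
    (hv : Spans v w) (ht : Spans t ζ) (ht' : Spans t' ζ') (hzw : z ≠ w) (hwζ : w ≠ ζ)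
    (hzζ : z ≠ ζ) (hwζ' : w ≠ ζ') (hzζ' : z ≠ ζ') {x : ℂ} (h : IsShearBend z w ζ ζ' x) :
    x = -(area v t * area u t' / (area v t' * area u t)) := by
  obtain ⟨s, s', α, A, hs, hs', hA, himg, rfl⟩ := h
  obtain ⟨k, hk, hcross⟩ := hA.crossTerm_eq hu hv ht ht' hzw himg
  have p1 := exp_of_isProjection hu hv ht hzw hs
  have p2 := exp_of_isProjection hu hv ht' hzw hs'
  have a1 := hv.area_ne_zero ht hwζ
  have a2 := hu.area_ne_zero ht hzζ
  have a3 := hv.area_ne_zero ht' hwζ'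
  have a4 := hu.area_ne_zero ht' hzζ'
  have n1 := norm_pos_iff.2 a1
  have n2 := norm_pos_iff.2 a2
  have n3 := norm_pos_iff.2 a3
  have n4 := norm_pos_iff.2 a4
  have m1 := normSq_pos hu.1
  have m2 := normSq_pos hv.1
  have hexp : Real.exp (s' - s) * (‖area v t'‖ * ‖area u t‖) = ‖area u t'‖ * ‖area v t‖ := by
    rw [Real.exp_sub]
    have e1 := Real.exp_pos s
    have e2 := Real.exp_pos s'
    rw [div_mul_eq_mul_div, div_eq_iff e1.ne']
    refine (pow_left_inj₀ (by positivity) (by positivity) two_ne_zero).1 ?_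
    refine mul_right_cancel₀ (mul_pos m1 m2).ne' ?_
    linear_combination (‖area u t‖ ^ 2 * normSq v) * p2 - (‖area u t'‖ ^ 2 * normSq v) * p1
  have hnorm : ‖Complex.exp (-α * Complex.I)‖ = 1 := by
    rw [← Complex.ofReal_neg, Complex.norm_exp_ofReal_mul_I]
  -- Taking norms determines the unknown positive factor `k`, which can then be eliminated.
  have hk' : ‖area v t'‖ * ‖area u t'‖ = k * (‖area v t‖ * ‖area u t‖) := by
    have := congrArg norm hcross
    rwa [norm_mul, hnorm, one_mul, norm_mul, norm_star, norm_mul, Complex.norm_real, Real.norm_eq_abs,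
      abs_of_pos hk, norm_mul, norm_star] at this
  have hexpC : (Real.exp (s' - s) : ℂ) * (‖area v t'‖ * ‖area u t‖) = ‖area u t'‖ * ‖area v t‖ := by
    exact_mod_cast hexp
  have hkC : (‖area v t'‖ : ℂ) * ‖area u t'‖ = k * (‖area v t‖ * ‖area u t‖) := by
    exact_mod_cast hk'
  have c2 : area u t * star (area u t) = ‖area u t‖ ^ 2 := Complex.mul_conj' _
  have c4 : area u t' * star (area u t') = ‖area u t'‖ ^ 2 := Complex.mul_conj' _
  have hx : Complex.exp (((s' - s : ℝ) : ℂ) + ((Real.pi - α : ℝ) : ℂ) * Complex.I) =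
      -(Real.exp (s' - s) * Complex.exp (-α * Complex.I)) := by
    rw [Complex.exp_add, Complex.ofReal_sub Real.pi, sub_mul, Complex.exp_sub, Complex.exp_pi_mul_I,
      Complex.ofReal_exp, neg_mul, Complex.exp_neg]
    field_simp
  rw [hx, neg_inj, eq_div_iff (mul_ne_zero a3 a2)]
  have N1 : (‖area v t‖ : ℂ) ≠ 0 := by exact_mod_cast n1.ne'
  have N2 : (‖area u t‖ : ℂ) ≠ 0 := by exact_mod_cast n2.ne'
  have N3 : (‖area v t'‖ : ℂ) ≠ 0 := by exact_mod_cast n3.ne'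
  have N4 : (‖area u t'‖ : ℂ) ≠ 0 := by exact_mod_cast n4.ne'
  refine mul_right_cancel₀ (mul_ne_zero (pow_ne_zero 2 N4) (mul_ne_zero N3 N2)) ?_
  have hcr : Complex.exp (-α * Complex.I) * (area v t' * area u t * (‖area u t'‖ : ℂ) ^ 2) =
      k * (area v t * area u t' * (‖area u t‖ : ℂ) ^ 2) := by
    rw [← c2, ← c4]
    linear_combination area u t * area u t' * hcross
  linear_combination (Real.exp (s' - s) * (‖area v t'‖ * ‖area u t‖) : ℂ) * hcr +
    (k * (area v t * area u t' * (‖area u t‖ : ℂ) ^ 2)) * hexpC -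
    (area v t * area u t' * ‖area u t'‖ * ‖area u t‖) * hkC

end Hyperbolic

/-! ### Orbits of permutations -/

/-- On the support, `q` and `f.cycleOf` have the same fibres, so their images are in bijection. -/
theorem card_image_support_eq {α β : Type*} [Fintype α] [DecidableEq α] [DecidableEq β]
    (f : Equiv.Perm α) (q : α → β) (hq : ∀ x y, q x = q y ↔ f.SameCycle x y) :
    (f.support.image q).card = f.cycleType.card := by
  have h : f.support.image f.cycleOf = f.cycleFactorsFinset := by
    ext c
    simp only [Finset.mem_image]
    constructor
    · rintro ⟨x, hx, rfl⟩
      exact Equiv.Perm.cycleOf_mem_cycleFactorsFinset_iff.2 hx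
    · intro hc
      obtain ⟨x, hx⟩ := (Equiv.Perm.mem_cycleFactorsFinset_iff.1 hc).1.nonempty_support
      exact ⟨x, Equiv.Perm.mem_cycleFactorsFinset_support_le hc hx,
        (Equiv.Perm.cycle_is_cycleOf hx hc).symm⟩
  rw [Equiv.Perm.cycleType_def, Multiset.card_map, Finset.card_val, ← h]
  have key : ∀ x ∈ f.support, ∀ y ∈ f.support, q x = q y ↔ f.cycleOf x = f.cycleOf y :=
    fun x hx y hy => by
      rw [hq, Equiv.Perm.sameCycle_iff_cycleOf_eq_of_mem_support hx hy]
  refine Finset.card_bij' (fun b hb => f.cycleOf (Finset.mem_image.1 hb).choose)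
    (fun c hc => q (Finset.mem_image.1 hc).choose) (fun b hb => ?_) (fun c hc => ?_)
    (fun b hb => ?_) (fun c hc => ?_)
  · exact Finset.mem_image_of_mem _ (Finset.mem_image.1 hb).choose_spec.1
  · exact Finset.mem_image_of_mem _ (Finset.mem_image.1 hc).choose_spec.1
  · have h1 := (Finset.mem_image.1 hb).choose_spec
    have h2 := (Finset.mem_image.1 (Finset.mem_image_of_mem f.cycleOf h1.1)).choose_spec
    exact ((key _ h2.1 _ h1.1).2 h2.2).trans h1.2
  · have h1 := (Finset.mem_image.1 hc).choose_spec
    have h2 := (Finset.mem_image.1 (Finset.mem_image_of_mem q h1.1)).choose_spec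
    exact ((key _ h2.1 _ h1.1).1 h2.2).trans h1.2

/-- A cycle of length `l` has sign `(-1)^(l + 1)`; a fixed point adds 1 to both cardinals and does
not affect the parity. -/
theorem sign_eq_of_orbits {α β : Type*} [Fintype α] [DecidableEq α] [Fintype β]
    (f : Equiv.Perm α) (q : α → β) (hs : Function.Surjective q)
    (hq : ∀ x y, q x = q y ↔ f.SameCycle x y) :
    (Equiv.Perm.sign f : ℤ) = (-1) ^ (Fintype.card α + Fintype.card β) := by
  classical
  have h1 : (f.supportᶜ.image q).card = f.supportᶜ.card := by
    refine Finset.card_image_of_injOn fun x hx y hy h => ?_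
    simp only [Finset.coe_compl, mem_compl_iff, Finset.mem_coe, Equiv.Perm.mem_support,
      not_not] at hx hy
    exact (Equiv.Perm.SameCycle.eq_of_left ((hq x y).1 h) hx)
  have h2 : Disjoint (f.support.image q) (f.supportᶜ.image q) := by
    rw [Finset.disjoint_left]
    intro b hb hb'
    obtain ⟨x, hx, rfl⟩ := Finset.mem_image.1 hb
    obtain ⟨y, hy, h⟩ := Finset.mem_image.1 hb'
    simp only [Finset.mem_compl, Equiv.Perm.mem_support, not_not] at hx hy
    have := Equiv.Perm.SameCycle.eq_of_left ((hq y x).1 h) hy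
    rw [this] at hy
    exact hx hy
  have h3 : f.support.image q ∪ f.supportᶜ.image q = Finset.univ := by
    rw [← Finset.image_union, Finset.union_compl]
    exact Finset.image_univ_of_surjective hs
  have h4 := congrArg Finset.card h3
  rw [Finset.card_union_of_disjoint h2, h1, card_image_support_eq f q hq, Finset.card_univ] at h4
  have h5 := Finset.card_add_card_compl f.support
  rw [Equiv.Perm.sign_of_cycleType, ← h4, ← h5, Equiv.Perm.sum_cycleType]
  push_cast
  rw [show f.support.card + f.supportᶜ.card + (f.cycleType.card + f.supportᶜ.card) =
    f.support.card + f.cycleType.card + 2 * f.supportᶜ.card by ring, pow_add _ _ (2 * _), pow_mul]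
  simp

theorem prod_sameCycle {α M : Type*} [Fintype α] [CommMonoid M] (f : Equiv.Perm α) (g : α → M)
    (x : α) (s : Finset α) (hs : ∀ y, y ∈ s ↔ f.SameCycle x y) :
    ∏ y ∈ s, g y = ∏ k ∈ Finset.range (Function.minimalPeriod f x), g (f^[k] x) := by
  classical
  have hpos : 0 < Function.minimalPeriod f x :=
    Function.minimalPeriod_pos_of_mem_periodicPts (f.injective.mem_periodicPts x)
  have : s = (Finset.range (Function.minimalPeriod f x)).image fun k => f^[k] x := by
    ext y
    rw [hs, Finset.mem_image]
    constructor
    · intro h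
      obtain ⟨i, -, hi⟩ := h.exists_pow_eq'
      rw [Equiv.Perm.coe_pow] at hi
      exact ⟨i % Function.minimalPeriod f x, Finset.mem_range.2 (Nat.mod_lt _ hpos), by
        rw [Function.iterate_mod_minimalPeriod_eq, hi]⟩
    · rintro ⟨k, -, rfl⟩
      exact ⟨k, by rw [zpow_natCast, Equiv.Perm.coe_pow]⟩
  rw [this, Finset.prod_image]
  intro a ha b hb h
  exact Function.iterate_injOn_Iio_minimalPeriod (Finset.mem_range.1 (Finset.mem_coe.1 ha))
    (Finset.mem_range.1 (Finset.mem_coe.1 hb)) h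

/-! ### Sides, corners, edges and vertices of a triangulation. -/

namespace Triangulation

variable {X : Type*} [TopologicalSpace X] (lam : Triangulation X)

/-- The rotation of the corners of each face. -/
def rotate : Equiv.Perm (lam.Face × Fin 3) := (Equiv.refl lam.Face).prodCongr (Equiv.addRight 2)

/-- The counterclockwise rotation around the vertices, as a permutation of the corners. -/
def turnPerm : Equiv.Perm (lam.Face × Fin 3) := lam.rotate.trans lam.mate

theorem coe_turnPerm : ⇑lam.turnPerm = lam.turn := rfl

theorem char_side (d : lam.Face × Fin 3) (s : I) :
    lam.char (lam.mate d).1 (Tri.side (lam.mate d).2 (σ s)) = lam.char d.1 (Tri.side d.2 s) :=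
  ((lam.char_eq_iff _ _ _ _).2 (Relation.EqvGen.rel _ _ ⟨d.2, _, s, rfl, rfl, rfl⟩)).symm

theorem vertexAt_turn (c : lam.Face × Fin 3) : lam.vertexAt (lam.turn c) = lam.vertexAt c := by
  have h := lam.char_side (c.1, c.2 + 2) 1
  rw [unitInterval.symm_one, Tri.side_zero, Tri.side_one] at h
  rw [show c.2 + 2 + 1 = c.2 by rw [add_assoc]; simp] at h
  exact h

theorem vertexAt_iterate (c : lam.Face × Fin 3) (k : ℕ) :
    lam.vertexAt (lam.turn^[k] c) = lam.vertexAt c := by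
  induction k with
  | zero => rfl
  | succ k ih => rw [Function.iterate_succ_apply', vertexAt_turn, ih]

/-- A point of a side is a vertex only at its ends. Crossing the side is one turn around its
terminal vertex, and an inverse turn around its initial vertex. -/
theorem sameCycle_of_glued {P Q : lam.Face × Tri} {i i' : Fin 3} {s : I}
    (hm : lam.mate (P.1, i) = (Q.1, i')) (hP : P.2 = Tri.side i s) (hQ : Q.2 = Tri.side i' (σ s))
    {a : Fin 3} (ha : P.2 = Tri.vertex a) :
    ∃ a', Q.2 = Tri.vertex a' ∧ lam.turnPerm.SameCycle (P.1, a) (Q.1, a') := by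
  have hcase : (s = 0 ∧ a = i) ∨ (s = 1 ∧ a = i + 1) := by
    have h2 := Tri.side_add_two i s
    have h1 := Tri.side_add_one i s
    rw [← hP, ha] at h1 h2
    have key : a = i ∨ a = i + 1 ∨ a = i + 2 := by
      fin_cases i <;> fin_cases a <;> simp
    rcases key with h | h | h <;> subst h
    · left
      exact ⟨Subtype.ext (h1.symm.trans (Tri.vertex_add_one a)), rfl⟩
    · right
      exact ⟨Subtype.ext (h1.symm.trans (Tri.vertex_self _)), rfl⟩
    · simp at h2
  rcases hcase with ⟨rfl, rfl⟩ | ⟨rfl, rfl⟩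
  · refine ⟨i' + 1, by rw [hQ, unitInterval.symm_zero, Tri.side_one], ?_⟩
    refine Equiv.Perm.SameCycle.symm ⟨1, ?_⟩
    rw [zpow_one, coe_turnPerm, turn]
    rw [show i' + 1 + 2 = i' by rw [add_assoc]; simp, ← hm, mate_mate]
  · refine ⟨i', by rw [hQ, unitInterval.symm_one, Tri.side_zero], 1, ?_⟩
    rw [zpow_one, coe_turnPerm, turn]
    rw [show i + 1 + 2 = i by rw [add_assoc]; simp, hm]

theorem glued_symm {P Q : lam.Face × Tri}
    (h : ∃ (i i' : Fin 3) (s : I), lam.mate (P.1, i) = (Q.1, i') ∧ P.2 = Tri.side i s ∧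
      Q.2 = Tri.side i' (σ s)) :
    ∃ (i i' : Fin 3) (s : I), lam.mate (Q.1, i) = (P.1, i') ∧ Q.2 = Tri.side i s ∧
      P.2 = Tri.side i' (σ s) := by
  obtain ⟨i, i', s, h1, h2, h3⟩ := h
  exact ⟨i', i, σ s, by rw [← h1, mate_mate], h3, by rw [h2, unitInterval.symm_symm]⟩

theorem exists_vertex_of_char_eq {c : lam.Face × Fin 3} {j : lam.Face} {y : Tri}
    (h : lam.vertexAt c = lam.char j y) :
    ∃ a, y = Tri.vertex a ∧ lam.turnPerm.SameCycle c (j, a) := by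
  -- Both directions are carried through the induction because the `symm` case exchanges them.
  have key : ∀ P Q : lam.Face × Tri, Relation.EqvGen (fun P Q : lam.Face × Tri =>
      ∃ (i i' : Fin 3) (s : I), lam.mate (P.1, i) = (Q.1, i') ∧ P.2 = Tri.side i s ∧
        Q.2 = Tri.side i' (σ s)) P Q →
      (∀ a, P.2 = Tri.vertex a → ∃ a', Q.2 = Tri.vertex a' ∧
        lam.turnPerm.SameCycle (P.1, a) (Q.1, a')) ∧
      (∀ a, Q.2 = Tri.vertex a → ∃ a', P.2 = Tri.vertex a' ∧
        lam.turnPerm.SameCycle (Q.1, a) (P.1, a')) := by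
    intro P Q h
    induction h with
    | rel P Q h =>
      refine ⟨fun a ha => ?_, fun a ha => ?_⟩
      · obtain ⟨i, i', s, h1, h2, h3⟩ := h
        exact lam.sameCycle_of_glued h1 h2 h3 ha
      · obtain ⟨i, i', s, h1, h2, h3⟩ := lam.glued_symm h
        exact lam.sameCycle_of_glued h1 h2 h3 ha
    | refl P => exact ⟨fun a ha => ⟨a, ha, .refl _ _⟩, fun a ha => ⟨a, ha, .refl _ _⟩⟩
    | symm P Q _ ih => exact ⟨ih.2, ih.1⟩
    | trans P Q R _ _ ih ih' =>
      refine ⟨fun a ha => ?_, fun a ha => ?_⟩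
      · obtain ⟨b, hb, h1⟩ := ih.1 a ha
        obtain ⟨c, hc, h2⟩ := ih'.1 b hb
        exact ⟨c, hc, h1.trans h2⟩
      · obtain ⟨b, hb, h1⟩ := ih'.2 a ha
        obtain ⟨c, hc, h2⟩ := ih.2 b hb
        exact ⟨c, hc, h1.trans h2⟩
  exact (key _ _ ((lam.char_eq_iff _ _ _ _).1 h)).1 c.2 rfl

theorem vertexAt_eq_iff (c c' : lam.Face × Fin 3) :
    lam.vertexAt c = lam.vertexAt c' ↔ lam.turnPerm.SameCycle c c' := by
  constructor
  · intro h
    obtain ⟨a, ha, h'⟩ := lam.exists_vertex_of_char_eq h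
    rwa [← Tri.vertex_inj ha] at h'
  · intro h
    obtain ⟨i, -, rfl⟩ := h.exists_pow_eq'
    rw [Equiv.Perm.coe_pow, coe_turnPerm, vertexAt_iterate]

theorem edge_eq_iff (d d' : lam.Face × Fin 3) :
    lam.edge d = lam.edge d' ↔ lam.mate.SameCycle d d' := Quotient.eq

theorem sameCycle_mate_iff (d d' : lam.Face × Fin 3) :
    lam.mate.SameCycle d d' ↔ d' = d ∨ d' = lam.mate d := by
  constructor
  · intro h
    obtain ⟨i, -, rfl⟩ := h.exists_pow_eq'
    have h2 : lam.mate ^ 2 = 1 := Equiv.ext fun d => lam.mate_mate d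
    rcases Nat.even_or_odd' i with ⟨k, rfl | rfl⟩
    · left; rw [pow_mul, h2, one_pow]; rfl
    · right; rw [pow_succ, pow_mul, h2, one_pow]; rfl
  · rintro (rfl | rfl)
    · exact .refl _ _
    · exact ⟨1, by simp⟩

/-- `mate` is an involution without fixed points, so an edge consists of exactly two sides, and the
choice of `d e` among them is irrelevant. -/
theorem prod_edges {M : Type*} [CommMonoid M] (y : lam.Face × Fin 3 → M)
    (d : lam.Edge → lam.Face × Fin 3) (hd : ∀ e, lam.edge (d e) = e) :
    ∏ e, (y (d e) * y (lam.mate (d e))) = ∏ c, y c := by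
  classical
  rw [← Finset.prod_fiberwise Finset.univ lam.edge y]
  refine Finset.prod_congr rfl fun e _ => ?_
  rw [show (Finset.univ.filter fun c => lam.edge c = e) = {d e, lam.mate (d e)} by
    ext c
    rw [Finset.mem_filter, Finset.mem_insert, Finset.mem_singleton, ← sameCycle_mate_iff,
      ← edge_eq_iff, hd]
    simp [eq_comm], Finset.prod_pair (lam.mate_ne _).symm]

end Triangulation

namespace IdealTriangulation

variable {X : Type*} [TopologicalSpace X] [ChartedSpace ℂ X] {V : Finset X}
  (lam : IdealTriangulation V)

theorem vertexAt_mem (c : lam.Face × Fin 3) : lam.vertexAt c ∈ V := (lam.mem_iff _).2 ⟨c, rfl⟩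

theorem char_mem_iff (j : lam.Face) (y : Tri) :
    lam.char j y ∈ V ↔ ∃ a, y = Tri.vertex a := by
  constructor
  · intro h
    obtain ⟨c, hc⟩ := (lam.mem_iff _).1 h
    obtain ⟨a, ha, -⟩ := lam.exists_vertex_of_char_eq hc
    exact ⟨a, ha⟩
  · rintro ⟨a, rfl⟩
    exact lam.vertexAt_mem (j, a)

theorem char_notMem (j : lam.Face) (x : OpenTri) : lam.char j x.1 ∉ V := fun h => by
  obtain ⟨a, ha⟩ := (lam.char_mem_iff j x.1).1 h
  exact x.2 a ha

/-- The orbits of `mate` are the edges, those of `turnPerm` the vertices. These permutations of the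
same set differ by a rotation whose cube is 1, hence even, so they have the same sign and their
numbers of orbits have the same parity. -/
theorem neg_one_pow_card_edge {R : Type*} [Ring R] :
    (-1 : R) ^ Fintype.card lam.Edge = (-1) ^ V.card := by
  classical
  have h1 := sign_eq_of_orbits lam.mate lam.edge Quotient.mk_surjective lam.edge_eq_iff
  have h2 := sign_eq_of_orbits lam.turnPerm (fun c => (⟨lam.vertexAt c, lam.vertexAt_mem c⟩ : V))
    (fun v => by
      obtain ⟨c, hc⟩ := (lam.mem_iff v.1).1 v.2
      exact ⟨c, Subtype.ext hc⟩)
    (fun c c' => by rw [Subtype.mk.injEq, lam.vertexAt_eq_iff])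
  have h3 : Equiv.Perm.sign lam.rotate = 1 := by
    have h : lam.rotate ^ 3 = 1 := by
      ext c
      · rfl
      · simp [pow_succ, Triangulation.rotate, add_assoc]
    have h' := congrArg Equiv.Perm.sign h
    rw [map_pow, map_one] at h'
    rcases Int.units_eq_one_or (Equiv.Perm.sign lam.rotate) with h0 | h0
    · exact h0
    · rw [h0] at h'
      exact absurd h' (by decide)
  rw [Triangulation.turnPerm, Equiv.Perm.sign_trans, h3, mul_one, h1, pow_add, pow_add,
    Fintype.card_coe] at h2
  have h4 := mul_left_cancel₀ (pow_ne_zero _ (by norm_num)) h2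
  have := congrArg (Int.cast : ℤ → R) h4
  simpa using this

theorem prod_corners {M : Type*} [CommMonoid M] (g : lam.Face × Fin 3 → M)
    (c : V → lam.Face × Fin 3) (hc : ∀ v, lam.vertexAt (c v) = v) :
    ∏ v, ∏ k ∈ Finset.range (lam.valence (c v)), g (lam.turn^[k] (c v)) = ∏ d, g d := by
  classical
  rw [← Finset.prod_fiberwise Finset.univ
    (fun c => (⟨lam.vertexAt c, lam.vertexAt_mem c⟩ : V)) g]
  refine Finset.prod_congr rfl fun v _ => ?_
  rw [prod_sameCycle lam.turnPerm g (c v) _ fun y => ?_]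
  · rfl
  · rw [Finset.mem_filter, ← lam.vertexAt_eq_iff, hc, Subtype.ext_iff]
    simp [eq_comm]

end IdealTriangulation

/-! ### Deck transformations -/

theorem locallyPathConnectedSpace_of_isLocalHomeomorph {E S : Type*} [TopologicalSpace E]
    [TopologicalSpace S] [LocallyPathConnectedSpace S] {p : E → S} (hp : IsLocalHomeomorph p) :
    LocallyPathConnectedSpace E := by
  choose e he using hp
  let _ : ChartedSpace S E :=
    { atlas := range e
      chartAt := e
      mem_chart_source := fun x => (he x).1
      chart_mem_atlas := fun x => ⟨x, rfl⟩ }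
  exact ChartedSpace.locallyPathConnectedSpace S E

section Deck

variable {E S : Type*} [TopologicalSpace E] {p : E → S}

theorem Deck.proj_apply (γ : Deck p) (y : E) : p (γ.1 y) = p y := γ.2 y

variable [TopologicalSpace S]

theorem Deck.eq_of_apply_eq [PreconnectedSpace E] (hp : IsCoveringMap p) {γ γ' : Deck p} {y : E}
    (h : γ.1 y = γ'.1 y) : γ = γ' := by
  refine Subtype.ext (Homeomorph.ext fun x => congrFun (hp.eq_of_comp_eq γ.1.continuous
    γ'.1.continuous ?_ y h) x)
  funext x
  exact (γ.2 x).trans (γ'.2 x).symm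

theorem Deck.exists_apply_eq [SimplyConnectedSpace E] [LocallyPathConnectedSpace E]
    (hp : IsCoveringMap p) {y y' : E} (h : p y = p y') : ∃ γ : Deck p, γ.1 y = y' := by
  have key : ∀ y y' : E, p y = p y' → ∃ F : C(E, E), F y = y' ∧ p ∘ F = p := fun y y' h =>
    (hp.existsUnique_continuousMap_lifts ⟨p, hp.continuous⟩ y y' h.symm).exists
  obtain ⟨F, hF, hF'⟩ := key y y' h
  obtain ⟨G, hG, hG'⟩ := key y' y h.symm
  have e1 : ⇑G ∘ ⇑F = id := hp.eq_of_comp_eq (G.continuous.comp F.continuous) continuous_id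
    (by rw [← Function.comp_assoc, hG', hF']; rfl) y (by simp [hF, hG])
  have e2 : ⇑F ∘ ⇑G = id := hp.eq_of_comp_eq (F.continuous.comp G.continuous) continuous_id
    (by rw [← Function.comp_assoc, hF', hG']; rfl) y' (by simp [hF, hG])
  exact ⟨⟨⟨⟨F, G, congrFun e1, congrFun e2⟩, F.continuous, G.continuous⟩, congrFun hF'⟩, hF⟩

end Deck

/-! ### Lifted faces -/

section LiftedFaces

variable {X : Type*} [TopologicalSpace X] [ChartedSpace ℂ X] {V : Finset X}
  {E : Type*} [TopologicalSpace E] {lam : IdealTriangulation V} {p : E → Punctured V}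

theorem locallyPathConnectedSpace_punctured [T2Space X] (V : Finset X) :
    LocallyPathConnectedSpace (Punctured V) := by
  have := ChartedSpace.locallyPathConnectedSpace ℂ X
  exact V.finite_toSet.isClosed.isOpen_compl.locallyPathConnectedSpace

theorem locallyPathConnectedSpace_cover [T2Space X] (hp : IsCoveringMap p) :
    LocallyPathConnectedSpace E :=
  have := locallyPathConnectedSpace_punctured V
  locallyPathConnectedSpace_of_isLocalHomeomorph hp.isLocalHomeomorph

variable (lam) in
/-- The characteristic map of a face, on the triangle with vertices deleted. -/
def openChar (j : lam.Face) (x : OpenTri) : Punctured V := ⟨lam.char j x.1, lam.char_notMem j x⟩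

theorem continuous_openChar (j : lam.Face) : Continuous (openChar lam j) :=
  ((lam.continuous_char j).comp continuous_subtype_val).subtype_mk _

theorem openChar_mate (d : lam.Face × Fin 3) (s : I) {x x' : OpenTri}
    (hx : x.1 = Tri.side d.2 s) (hx' : x'.1 = Tri.side (lam.mate d).2 (σ s)) :
    openChar lam (lam.mate d).1 x' = openChar lam d.1 x := by
  refine Subtype.ext ?_
  simp only [openChar, hx, hx']
  exact lam.char_side d s

namespace LiftedFace

theorem proj_map (T : LiftedFace lam p) (x : OpenTri) : p (T.map x) = openChar lam T.face x :=
  Subtype.ext (T.lifts x)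

@[ext] theorem ext {T T' : LiftedFace lam p} (h : T.face = T'.face) (h' : T.map = T'.map) :
    T = T' := by
  cases T; cases T'; subst h; subst h'; rfl

theorem eq_of_map_eq (hp : IsCoveringMap p) {T T' : LiftedFace lam p} (h : T.face = T'.face)
    {x : OpenTri} (hx : T.map x = T'.map x) : T = T' := by
  refine LiftedFace.ext h (hp.eq_of_comp_eq T.continuous_map T'.continuous_map ?_ x hx)
  funext x
  simp only [Function.comp, proj_map, h]

theorem exists_of_proj_eq (hp : IsCoveringMap p) {j : lam.Face} {x : OpenTri} {y : E}
    (h : p y = openChar lam j x) : ∃ T : LiftedFace lam p, T.face = j ∧ T.map x = y := by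
  obtain ⟨F, hF, hF'⟩ := (hp.existsUnique_continuousMap_lifts
    ⟨openChar lam j, continuous_openChar j⟩ x y h).exists
  exact ⟨⟨j, F, F.continuous, fun x => congrArg Subtype.val (congrFun hF' x)⟩, rfl, hF⟩

theorem exists_map_eq (hp : IsCoveringMap p) (lam : IdealTriangulation V) (y : E) :
    ∃ (T : LiftedFace lam p) (x : OpenTri), T.map x = y := by
  obtain ⟨j, x, hx⟩ := lam.surjective_char (p y).1
  have hx' : ∀ a, x ≠ Tri.vertex a := fun a ha =>
    (p y).2 (by rw [← hx]; exact (lam.char_mem_iff j x).2 ⟨a, ha⟩)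
  obtain ⟨T, -, hT⟩ := exists_of_proj_eq hp (lam := lam) (j := j) (x := ⟨x, hx'⟩) (y := y)
    (Subtype.ext hx.symm)
  exact ⟨T, _, hT⟩

instance : MulAction (Deck p) (LiftedFace lam p) where
  smul γ T := ⟨T.face, fun x => γ.1 (T.map x), γ.1.continuous.comp T.continuous_map, fun x => by
    rw [Deck.proj_apply γ]; exact T.lifts x⟩
  one_smul _ := rfl
  mul_smul _ _ _ := rfl

@[simp] theorem smul_face (γ : Deck p) (T : LiftedFace lam p) : (γ • T).face = T.face := rfl

@[simp] theorem smul_map (γ : Deck p) (T : LiftedFace lam p) (x : OpenTri) :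
    (γ • T).map x = γ.1 (T.map x) := rfl

theorem exists_smul_eq [SimplyConnectedSpace E] [LocallyPathConnectedSpace E]
    (hp : IsCoveringMap p) {T T' : LiftedFace lam p} (h : T.face = T'.face) :
    ∃ γ : Deck p, γ • T = T' := by
  have x : OpenTri := Classical.arbitrary _
  obtain ⟨γ, hγ⟩ := Deck.exists_apply_eq hp (y := T.map x) (y' := T'.map x)
    (by rw [T.proj_map, T'.proj_map, h])
  exact ⟨γ, eq_of_map_eq hp h hγ⟩

theorem smul_left_cancel [PreconnectedSpace E] (hp : IsCoveringMap p) {γ γ' : Deck p}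
    {T : LiftedFace lam p} (h : γ • T = γ' • T) : γ = γ' := by
  have x : OpenTri := Classical.arbitrary _
  exact Deck.eq_of_apply_eq hp (y := T.map x) (congrArg (fun T => T.map x) h)

/-- Along the open side, which is connected, both maps lift the same path of the surface, so
agreement at one point propagates. -/
theorem Adjacent.of_map_eq (hp : IsCoveringMap p) {T T' : LiftedFace lam p} {i i' : Fin 3}
    (h : lam.mate (T.face, i) = (T'.face, i')) {x x' : OpenTri} {s : I} (hx : x.1 = Tri.side i s)
    (hx' : x'.1 = Tri.side i' (σ s)) (hxx' : T.map x = T'.map x') : T.Adjacent i T' i' := by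
  refine ⟨h, fun y y' t hy hy' => ?_⟩
  have hs := OpenTri.mem_Ioo_of_eq_side hx
  have ht := OpenTri.mem_Ioo_of_eq_side hy
  have hsymm : ∀ u : Ioo (0 : ℝ) 1, 1 - (u : ℝ) ∈ Ioo (0 : ℝ) 1 := fun u =>
    ⟨by linarith [u.2.2], by linarith [u.2.1]⟩
  have : PreconnectedSpace (Ioo (0 : ℝ) 1) :=
    isPreconnected_iff_preconnectedSpace.1 isPreconnected_Ioo
  have key := hp.eq_of_comp_eq (g₁ := fun u : Ioo (0 : ℝ) 1 => T.map (OpenTri.side i u))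
    (g₂ := fun u : Ioo (0 : ℝ) 1 => T'.map (OpenTri.side i' ⟨1 - u, hsymm u⟩))
    (T.continuous_map.comp (by fun_prop))
    (T'.continuous_map.comp ((OpenTri.continuous_side i').comp (by fun_prop)))
    (by
      funext u
      simp only [Function.comp, proj_map]
      have := openChar_mate (lam := lam) (T.face, i) ⟨u, Ioo_subset_Icc_self u.2⟩
        (x := OpenTri.side i u) (x' := OpenTri.side i' ⟨1 - u, hsymm u⟩) rfl (by rw [h]; rfl)
      rw [h] at this
      exact this.symm) ⟨s, hs⟩ (by
      have e1 : x = OpenTri.side i ⟨s, hs⟩ := Subtype.ext hx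
      have e2 : x' = OpenTri.side i' ⟨1 - s, hsymm ⟨s, hs⟩⟩ := Subtype.ext hx'
      rwa [e1, e2] at hxx')
  have e1 : y = OpenTri.side i ⟨t, ht⟩ := Subtype.ext hy
  have e2 : y' = OpenTri.side i' ⟨1 - t, hsymm ⟨t, ht⟩⟩ := Subtype.ext hy'
  rw [e1, e2]
  exact congrFun key ⟨t, ht⟩

theorem Adjacent.symm {T T' : LiftedFace lam p} {i i' : Fin 3} (h : T.Adjacent i T' i') :
    T'.Adjacent i' T i :=
  ⟨by rw [← h.1, lam.mate_mate], fun x x' s hx hx' =>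
    (h.2 x' x (σ s) hx' (by rw [unitInterval.symm_symm, hx])).symm⟩

theorem Adjacent.smul (γ : Deck p) {T T' : LiftedFace lam p} {i i' : Fin 3}
    (h : T.Adjacent i T' i') : (γ • T).Adjacent i (γ • T') i' :=
  ⟨h.1, fun x x' s hx hx' => congrArg γ.1 (h.2 x x' s hx hx')⟩

theorem exists_adjacent (hp : IsCoveringMap p) (T : LiftedFace lam p) (i : Fin 3) :
    ∃ (T' : LiftedFace lam p) (i' : Fin 3), T.Adjacent i T' i' := by
  have hh : (1 / 2 : ℝ) ∈ Ioo (0 : ℝ) 1 := by norm_num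
  set i' := (lam.mate (T.face, i)).2
  have hs : (OpenTri.side i' ⟨1 / 2, hh⟩).1 = Tri.side i' (σ ⟨1 / 2, Ioo_subset_Icc_self hh⟩) :=
    congrArg (Tri.side i') (Subtype.ext (by simp; norm_num))
  obtain ⟨T', hT', hx⟩ := exists_of_proj_eq hp (lam := lam) (j := (lam.mate (T.face, i)).1)
    (x := OpenTri.side i' ⟨1 / 2, hh⟩) (y := T.map (OpenTri.side i ⟨1 / 2, hh⟩))
    (by rw [T.proj_map]; exact (openChar_mate (T.face, i) _ rfl hs).symm)
  exact ⟨T', i', Adjacent.of_map_eq hp (by rw [hT']) rfl hs hx.symm⟩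

theorem Adjacent.unique (hp : IsCoveringMap p) {T T₁ T₂ : LiftedFace lam p} {i i₁ i₂ : Fin 3}
    (h₁ : T.Adjacent i T₁ i₁) (h₂ : T.Adjacent i T₂ i₂) : T₁ = T₂ ∧ i₁ = i₂ := by
  have h := h₁.1.symm.trans h₂.1
  rw [Prod.mk.injEq] at h
  obtain ⟨hf, rfl⟩ := h
  have hh : (1 / 2 : ℝ) ∈ Ioo (0 : ℝ) 1 := by norm_num
  have hs : (OpenTri.side i₁ ⟨1 / 2, hh⟩).1 = Tri.side i₁ (σ ⟨1 / 2, Ioo_subset_Icc_self hh⟩) :=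
    congrArg (Tri.side i₁) (Subtype.ext (by simp; norm_num))
  refine ⟨eq_of_map_eq hp hf (x := OpenTri.side i₁ ⟨1 / 2, hh⟩) ?_, rfl⟩
  rw [← h₁.2 (OpenTri.side i ⟨1 / 2, hh⟩) _ _ rfl hs, ← h₂.2 (OpenTri.side i ⟨1 / 2, hh⟩) _ _ rfl hs]

end LiftedFace

/-! ### The topology of the covering is determined by the lifted faces -/

/-- The complement, with the punctures added, is a finite union of images of compact sets, hence
closed in the Hausdorff space `X`. -/
theorem isOpen_punctured_of_forall_face [T2Space X] (lam : IdealTriangulation V)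
    {W : Set (Punctured V)} (h : ∀ j, IsOpen (openChar lam j ⁻¹' W)) : IsOpen W := by
  set Z : Set X := {x | ∀ hx : x ∉ V, (⟨x, hx⟩ : Punctured V) ∉ W} with hZ
  have hopen : IsOpen {x : Tri | ∀ a, x ≠ Tri.vertex a} := by
    rw [ofPred_forall]
    exact isOpen_iInter_of_finite fun a => isOpen_ne
  have hclosed : IsClosed Z := by
    have h1 : ∀ j, IsClosed (lam.char j ⁻¹' Z) := fun j => by
      rw [← isOpen_compl_iff]
      have h2 : (lam.char j ⁻¹' Z)ᶜ = Subtype.val '' (openChar lam j ⁻¹' W) := by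
        ext x
        constructor
        · intro hx
          simp only [hZ, mem_compl_iff, mem_preimage, mem_ofPred_eq, not_forall, not_not] at hx
          obtain ⟨hx, hx'⟩ := hx
          exact ⟨⟨x, fun a ha => hx ((lam.char_mem_iff j x).2 ⟨a, ha⟩)⟩, hx', rfl⟩
        · rintro ⟨x, hx, rfl⟩ hx'
          exact hx' (lam.char_notMem j x) hx
      rw [h2]
      exact hopen.isOpenMap_subtype_val _ (h j)
    have h3 : Z = ⋃ j, lam.char j '' (lam.char j ⁻¹' Z) := by
      ext x
      simp only [mem_iUnion]
      constructor
      · intro hx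
        obtain ⟨j, y, rfl⟩ := lam.surjective_char x
        exact ⟨j, y, hx, rfl⟩
      · rintro ⟨j, y, hy, rfl⟩
        exact hy
    rw [h3]
    exact isClosed_iUnion_of_finite fun j =>
      ((h1 j).isCompact.image (lam.continuous_char j)).isClosed
  have : W = Subtype.val ⁻¹' Zᶜ := by
    ext x
    simp [hZ, x.2]
  rw [this]
  exact hclosed.isOpen_compl.preimage continuous_subtype_val

/-- Near a point `p` is injective, so openness can be tested on the image in the surface, and there
face by face: a point of `E` above a point of a face lies on a lift of this face. -/
theorem isOpen_of_forall_liftedFace [T2Space X] (hp : IsCoveringMap p) (lam : IdealTriangulation V)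
    {W : Set E} (h : ∀ T : LiftedFace lam p, IsOpen (T.map ⁻¹' W)) : IsOpen W := by
  rw [isOpen_iff_mem_nhds]
  intro y hy
  obtain ⟨e, hye, he⟩ := hp.isLocalHomeomorph y
  have hW' : IsOpen (p '' (W ∩ e.source)) := by
    refine isOpen_punctured_of_forall_face lam fun j => isOpen_iff_mem_nhds.2 fun x hx => ?_
    obtain ⟨y', hy', hx⟩ := hx
    obtain ⟨T, rfl, rfl⟩ := LiftedFace.exists_of_proj_eq hp hx
    filter_upwards [(h T).mem_nhds hy'.1,
      (e.open_source.preimage T.continuous_map).mem_nhds hy'.2] with x' h1 h2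
    exact ⟨T.map x', ⟨h1, h2⟩, T.proj_map x'⟩
  filter_upwards [e.open_source.mem_nhds hye,
    (hW'.preimage hp.continuous).mem_nhds ⟨y, ⟨hy, hye⟩, rfl⟩] with y' h1 h2
  obtain ⟨y'', h3, h4⟩ := h2
  rw [he] at h4
  rw [← e.injOn h3.2 h1 h4]
  exact h3.1

/-! ### Gluing maps defined on the lifted faces. -/

/-- Points with the same image in the surface are joined by a chain of gluings. All its faces are
lifted through the same point of `E`, and each gluing becomes an adjacency. -/
theorem LiftedFace.compatible_of_adjacent (hp : IsCoveringMap p) {Z : Type*}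
    (φ : LiftedFace lam p → OpenTri → Z)
    (hφ : ∀ (T T' : LiftedFace lam p) (i i' : Fin 3), T.Adjacent i T' i' → ∀ (x x' : OpenTri) (s : I),
      x.1 = Tri.side i s → x'.1 = Tri.side i' (σ s) → φ T x = φ T' x')
    {T T' : LiftedFace lam p} {x x' : OpenTri} (h : T.map x = T'.map x') : φ T x = φ T' x' := by
  have key : ∀ P Q : lam.Face × Tri, Relation.EqvGen (fun P Q : lam.Face × Tri =>
      ∃ (i i' : Fin 3) (s : I), lam.mate (P.1, i) = (Q.1, i') ∧ P.2 = Tri.side i s ∧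
        Q.2 = Tri.side i' (σ s)) P Q → ∀ (T T' : LiftedFace lam p) (x x' : OpenTri),
      T.face = P.1 → x.1 = P.2 → T'.face = Q.1 → x'.1 = Q.2 → T.map x = T'.map x' →
        φ T x = φ T' x' := by
    intro P Q h
    induction h with
    | rel P Q h =>
      rintro T T' x x' h1 h2 h3 h4 h5
      obtain ⟨i, i', s, h6, h7, h8⟩ := h
      rw [← h2] at h7
      rw [← h4] at h8
      rw [← h1, ← h3] at h6
      exact hφ T T' i i' (Adjacent.of_map_eq hp h6 h7 h8 h5) x x' s h7 h8
    | refl P =>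
      rintro T T' x x' h1 h2 h3 h4 h5
      obtain rfl : x = x' := Subtype.ext (h2.trans h4.symm)
      rw [eq_of_map_eq hp (h1.trans h3.symm) h5]
    | symm P Q _ ih =>
      rintro T T' x x' h1 h2 h3 h4 h5
      exact (ih T' T x' x h3 h4 h1 h2 h5.symm).symm
    | trans P Q R hPQ _ ih ih' =>
      rintro T T' x x' h1 h2 h3 h4 h5
      -- The intermediate face of the chain is lifted through the point `T.map x`.
      have hc : lam.char P.1 P.2 = lam.char Q.1 Q.2 := (lam.char_eq_iff _ _ _ _).2 hPQ
      have hy : (p (T.map x)).1 = lam.char Q.1 Q.2 := by rw [T.lifts, h1, h2, hc]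
      obtain ⟨T₁, h6, h7⟩ := exists_of_proj_eq hp (lam := lam) (j := Q.1) (y := T.map x)
        (x := ⟨Q.2, fun a ha => (p (T.map x)).2 (by
          rw [hy]; exact (lam.char_mem_iff _ _).2 ⟨a, ha⟩)⟩) (Subtype.ext hy)
      exact (ih T T₁ x _ h1 h2 h6 rfl h7.symm).trans (ih' T₁ T' _ x' h6 rfl h3 h4 (h7.trans h5))
  refine key (T.face, x.1) (T'.face, x'.1) ((lam.char_eq_iff _ _ _ _).1 ?_) T T' x x' rfl rfl rfl
    rfl h
  rw [← T.lifts, ← T'.lifts, h]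

theorem LiftedFace.exists_continuous_glue [T2Space X] (hp : IsCoveringMap p) {Z : Type*}
    [TopologicalSpace Z] (φ : LiftedFace lam p → OpenTri → Z) (hc : ∀ T, Continuous (φ T))
    (hφ : ∀ (T T' : LiftedFace lam p) (i i' : Fin 3), T.Adjacent i T' i' → ∀ (x x' : OpenTri) (s : I),
      x.1 = Tri.side i s → x'.1 = Tri.side i' (σ s) → φ T x = φ T' x') :
    ∃ F : C(E, Z), ∀ T x, F (T.map x) = φ T x := by
  choose T x hTx using exists_map_eq hp lam
  have hF : ∀ T' x', φ (T (T'.map x')) (x (T'.map x')) = φ T' x' := fun T' x' =>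
    compatible_of_adjacent hp φ hφ (hTx _)
  refine ⟨⟨fun y => φ (T y) (x y), ⟨fun U hU => isOpen_of_forall_liftedFace hp lam fun T' => ?_⟩⟩, hF⟩
  convert hU.preimage (hc T') using 1
  ext x'
  simp only [mem_preimage, hF]

/-- Adjacency connects all lifted faces because `E` is connected: the truth value of `P` glues to a
continuous map to `Bool`. -/
theorem LiftedFace.forall_of_adjacent [T2Space X] [PreconnectedSpace E] (hp : IsCoveringMap p)
    (P : LiftedFace lam p → Prop)
    (hP : ∀ (T T' : LiftedFace lam p) (i i' : Fin 3), T.Adjacent i T' i' → P T → P T')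
    (T₀ : LiftedFace lam p) (h₀ : P T₀) (T : LiftedFace lam p) : P T := by
  classical
  obtain ⟨F, hF⟩ := exists_continuous_glue hp (fun T (_ : OpenTri) => decide (P T))
    (fun T => continuous_const) (fun T T' i i' h x x' s _ _ => by
      simp only [decide_eq_decide]
      exact ⟨hP T T' i i' h, hP T' T i' i h.symm⟩)
  have x : OpenTri := Classical.arbitrary _
  have h := PreconnectedSpace.constant ‹_› F.continuous (x := T₀.map x) (y := T.map x)
  rw [hF, hF, decide_eq_decide] at h
  exact h.1 h₀

end LiftedFaces

/-! ### Integer cocycles on the lifted faces are coboundaries -/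

/-- A function on the triangle with vertices deleted, which is `1/2` on the `i`-th side and `0`
on the other sides. -/
def OpenTri.bump (i : Fin 3) (x : OpenTri) : ℝ :=
  x.1.1 i * x.1.1 (i + 1) /
    (2 * (x.1.1 i * x.1.1 (i + 1) + x.1.1 (i + 1) * x.1.1 (i + 2) + x.1.1 (i + 2) * x.1.1 i))

theorem OpenTri.bump_denom_pos (i : Fin 3) (x : OpenTri) :
    0 < x.1.1 i * x.1.1 (i + 1) + x.1.1 (i + 1) * x.1.1 (i + 2) + x.1.1 (i + 2) * x.1.1 i := by
  have h := x.1.sum_eq i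
  have h0 := x.1.nonneg i
  have h1 := x.1.nonneg (i + 1)
  have h2 := x.1.nonneg (i + 2)
  have l0 := x.coord_lt_one i
  have l1 := x.coord_lt_one (i + 1)
  rcases h0.eq_or_lt with h0 | h0
  · rw [← h0] at h ⊢
    have : 0 < x.1.1 (i + 1) := by
      have l2 := x.coord_lt_one (i + 2)
      linarith
    have : 0 < x.1.1 (i + 2) := by linarith
    simp only [zero_mul, mul_zero, zero_add, add_zero]
    positivity
  · have : 0 < x.1.1 (i + 1) + x.1.1 (i + 2) := by linarith
    have e := mul_pos h0 this
    have e' := mul_nonneg h1 h2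
    nlinarith

theorem OpenTri.continuous_bump (i : Fin 3) : Continuous (OpenTri.bump i) := by
  have hc : ∀ b : Fin 3, Continuous fun x : OpenTri => x.1.1 b := fun b =>
    (Tri.continuous_coord b).comp continuous_subtype_val
  refine Continuous.div ((hc _).mul (hc _)) (continuous_const.mul
    ((((hc _).mul (hc _)).add ((hc _).mul (hc _))).add ((hc _).mul (hc _)))) fun x => ?_
  exact (mul_pos two_pos (OpenTri.bump_denom_pos i x)).ne'

theorem OpenTri.bump_self {x : OpenTri} {i : Fin 3} {s : I} (h : x.1 = Tri.side i s) :
    x.bump i = 1 / 2 := by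
  have hs := OpenTri.mem_Ioo_of_eq_side h
  have h0 : (1 - (s : ℝ)) ≠ 0 := by linarith [hs.2]
  have h1 : (s : ℝ) ≠ 0 := hs.1.ne'
  rw [OpenTri.bump, h, Tri.side_apply, Tri.side_add_one, Tri.side_add_two]
  field_simp
  simp

theorem OpenTri.bump_of_ne {x : OpenTri} {i b : Fin 3} {s : I} (h : x.1 = Tri.side i s)
    (hb : b ≠ i) : x.bump b = 0 := by
  have h2 := Tri.side_add_two i s
  rw [← h] at h2
  have key : b = i + 2 ∨ b + 1 = i + 2 := by
    revert hb; fin_cases i <;> fin_cases b <;> simp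
  rw [OpenTri.bump]
  rcases key with rfl | h'
  · rw [h2, zero_mul, zero_div]
  · rw [h', h2, mul_zero, zero_div]

theorem Circle.exp_pi_mul_int (k : ℤ) :
    Circle.exp (2 * Real.pi * ((k : ℝ) * (1 / 2))) =
      Circle.exp (2 * Real.pi * (((-k : ℤ) : ℝ) * (1 / 2))) := by
  rw [Circle.exp_eq_exp]
  exact ⟨k, by push_cast; ring⟩

section

variable {X : Type*} [TopologicalSpace X] [ChartedSpace ℂ X] {V : Finset X}
  {E : Type*} [TopologicalSpace E] {lam : IdealTriangulation V} {p : E → Punctured V}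

/-- The angle `ψ T` equals `π o T i` on the `i`-th side, and `-π o T i` on the same side seen from
the adjacent face. These agree modulo `2π`, so the angles glue to a map from `E` to the circle,
which lifts to a real function `G`. On `T`, `G` is `ψ T + 2π n T`; comparing along a common side
gives the relation for `n`. -/
theorem LiftedFace.exists_int_primitive [T2Space X] [SimplyConnectedSpace E] (hp : IsCoveringMap p)
    (o : LiftedFace lam p → Fin 3 → ℤ)
    (ho : ∀ (T T' : LiftedFace lam p) (i i' : Fin 3), T.Adjacent i T' i' → o T' i' = -o T i) :
    ∃ n : LiftedFace lam p → ℤ, ∀ (T T' : LiftedFace lam p) (i i' : Fin 3), T.Adjacent i T' i' →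
      n T' = n T + o T i := by
  have := locallyPathConnectedSpace_cover hp
  set ψ : LiftedFace lam p → OpenTri → ℝ := fun T x =>
    2 * Real.pi * ∑ i, (o T i : ℝ) * x.bump i with hψ
  have hψc : ∀ T, Continuous (ψ T) := fun T =>
    continuous_const.mul (continuous_finsetSum _ fun i _ =>
      continuous_const.mul (OpenTri.continuous_bump i))
  have hside : ∀ T i (x : OpenTri) (s : I), x.1 = Tri.side i s →
      ψ T x = 2 * Real.pi * ((o T i : ℝ) * (1 / 2)) := fun T i x s h => by
    simp only [hψ]
    rw [Finset.sum_eq_single i (fun b _ hb => by rw [OpenTri.bump_of_ne h hb, mul_zero])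
      (fun hi => absurd (Finset.mem_univ i) hi), OpenTri.bump_self h]
  obtain ⟨F, hF⟩ := LiftedFace.exists_continuous_glue (lam := lam) hp
    (fun T x => Circle.exp (ψ T x)) (fun T => Circle.exp.continuous.comp (hψc T))
    (fun T T' i i' h x x' s hx hx' => by
      simp only [hside T i x s hx, hside T' i' x' _ hx', ho T T' i i' h]
      exact Circle.exp_pi_mul_int _)
  have y₀ : E := Classical.arbitrary _
  obtain ⟨r₀, hr₀⟩ : ∃ r₀ : ℝ, Circle.exp r₀ = F y₀ :=
    ⟨_, Circle.exp_arg _⟩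
  obtain ⟨G, -, hG⟩ := (Circle.isCoveringMap_exp.existsUnique_continuousMap_lifts F y₀ r₀ hr₀).exists
  have hn : ∀ T : LiftedFace lam p, ∃ n : ℤ, ∀ x, G (T.map x) = ψ T x + n * (2 * Real.pi) := by
    intro T
    have x₀ : OpenTri := Classical.arbitrary _
    have h1 : ∀ x, Circle.exp (G (T.map x)) = Circle.exp (ψ T x) := fun x =>
      (congrFun hG _).trans (hF T x)
    obtain ⟨n, hn⟩ := Circle.exp_eq_exp.1 (h1 x₀)
    refine ⟨n, fun x => congrFun (Circle.isCoveringMap_exp.eq_of_comp_eq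
      (g₁ := fun x => G (T.map x)) (g₂ := fun x => ψ T x + n * (2 * Real.pi))
      (G.continuous.comp T.continuous_map) ((hψc T).add continuous_const) ?_ x₀ hn) x⟩
    funext x
    simp only [Function.comp]
    rw [h1, Circle.exp_eq_exp]
    exact ⟨-n, by push_cast; ring⟩
  choose n hn using hn
  refine ⟨n, fun T T' i i' h => ?_⟩
  have hh : (1 / 2 : ℝ) ∈ Ioo (0 : ℝ) 1 := by norm_num
  have hs : (OpenTri.side i' ⟨1 / 2, hh⟩).1 = Tri.side i' (σ ⟨1 / 2, Ioo_subset_Icc_self hh⟩) :=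
    congrArg (Tri.side i') (Subtype.ext (by simp; norm_num))
  have e1 := hn T (OpenTri.side i ⟨1 / 2, hh⟩)
  have e2 := hn T' (OpenTri.side i' ⟨1 / 2, hh⟩)
  rw [hside T i _ _ rfl] at e1
  rw [hside T' i' _ _ rfl, ho T T' i i' h, ← h.2 (OpenTri.side i ⟨1 / 2, hh⟩) _ _ rfl hs, e1] at e2
  have hpi := Real.pi_pos
  push_cast at e2
  have : (n T' : ℝ) = n T + o T i := by
    refine mul_right_cancel₀ (mul_pos two_pos hpi).ne' ?_
    linarith
  exact_mod_cast this

/-! ### Lifting homomorphisms to the double covering `SL₂(ℂ) → PSL₂(ℂ)` -/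

/-- Here `κ = -1`. Only these properties are used to correct signs. -/
theorem exists_central_involution : ∃ κ : SL2C, κ ^ 2 = 1 ∧ (∀ A : SL2C, Commute κ A) ∧
    (QuotientGroup.mk κ : PSL2C) = 1 ∧
    ∀ A B : SL2C, (QuotientGroup.mk A : PSL2C) = QuotientGroup.mk B → B = A ∨ B = A * κ := by
  have hc : ∀ C : SL2C, C ∈ Subgroup.center SL2C ↔ C = 1 ∨ C = -1 := fun C => by
    rw [Matrix.SpecialLinearGroup.mem_center_iff]
    constructor
    · rintro ⟨r, hr, h⟩
      rw [Fintype.card_fin, sq_eq_one_iff] at hr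
      rcases hr with rfl | rfl
      · left; exact Subtype.ext (by rw [← h, map_one]; rfl)
      · right; exact Subtype.ext (by rw [← h, map_neg, map_one]; rfl)
    · rintro (rfl | rfl)
      · exact ⟨1, by simp, by simp⟩
      · exact ⟨-1, by simp, by rw [map_neg, map_one]; rfl⟩
  have hκ := (hc (-1)).2 (Or.inr rfl)
  refine ⟨-1, by simp, fun A => (Subgroup.mem_center_iff.1 hκ A).symm,
    (QuotientGroup.eq_one_iff _).2 hκ, fun A B h => ?_⟩
  rcases (hc _).1 (QuotientGroup.eq.1 h) with h | h
  · left; rw [inv_mul_eq_one] at h; exact h.symm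
  · right; rw [← h, mul_inv_cancel_left]

/-- One of the two sides of each edge is singled out. Multiplication by `ω` makes a symmetric
function of the sides antisymmetric without changing it modulo 2. -/
theorem Triangulation.exists_orientation {X : Type*} [TopologicalSpace X] (lam : Triangulation X) :
    ∃ ω : lam.Face × Fin 3 → ℤ, (∀ d, ω d = 1 ∨ ω d = -1) ∧ ∀ d, ω (lam.mate d) = -ω d := by
  classical
  obtain ⟨rep, hrep⟩ : ∃ rep : lam.Edge → lam.Face × Fin 3, ∀ e, lam.edge (rep e) = e :=
    ⟨_, Function.surjInv_eq (f := lam.edge) Quotient.mk_surjective⟩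
  have key : ∀ d, (rep (lam.edge d) = d ∧ rep (lam.edge (lam.mate d)) ≠ lam.mate d) ∨
      (rep (lam.edge d) ≠ d ∧ rep (lam.edge (lam.mate d)) = lam.mate d) := fun d => by
    have h : lam.edge (lam.mate d) = lam.edge d :=
      (lam.edge_eq_iff _ _).2 ((lam.sameCycle_mate_iff _ _).2 (Or.inr (lam.mate_mate d).symm))
    rw [h]
    rcases (lam.sameCycle_mate_iff _ _).1 ((lam.edge_eq_iff _ _).1 (hrep (lam.edge d)).symm)
      with h1 | h1
    · exact Or.inl ⟨h1, fun h2 => lam.mate_ne d (h2.symm.trans h1)⟩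
    · exact Or.inr ⟨fun h2 => lam.mate_ne d (h1.symm.trans h2), h1⟩
  refine ⟨fun d => if rep (lam.edge d) = d then 1 else -1, fun d => ?_, fun d => ?_⟩
  · dsimp only
    split_ifs <;> simp
  · dsimp only
    rcases key d with ⟨h1, h2⟩ | ⟨h1, h2⟩
    · rw [if_neg h2, if_pos h1]
    · rw [if_pos h2, if_neg h1, neg_neg]

/-- Since no side is glued to itself, one side of each edge can be lifted freely, the other one
receiving the inverse. -/
theorem Triangulation.exists_antisymm_lift {X : Type*} [TopologicalSpace X] (lam : Triangulation X)
    {G Q : Type*} [Group G] [Group Q] (π : G →* Q) (hπ : Function.Surjective π)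
    (τ : lam.Face × Fin 3 → Q) (hτ : ∀ d, τ (lam.mate d) = (τ d)⁻¹) :
    ∃ M : lam.Face × Fin 3 → G, (∀ d, π (M d) = τ d) ∧ ∀ d, M (lam.mate d) = (M d)⁻¹ := by
  choose L hL using hπ
  obtain ⟨ω, hω, hωm⟩ := lam.exists_orientation
  refine ⟨fun d => if ω d = 1 then L (τ d) else (L (τ (lam.mate d)))⁻¹, fun d => ?_, fun d => ?_⟩
  · dsimp only
    split_ifs
    · exact hL _
    · rw [map_inv, hL, hτ, inv_inv]
  · dsimp only
    rcases hω d with h | h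
    · rw [if_neg (by rw [hωm, h]; decide), if_pos h, lam.mate_mate]
    · rw [if_pos (by rw [hωm, h, neg_neg]), if_neg (by rw [h]; decide), inv_inv]

theorem exists_face_representatives [Nonempty E] (hp : IsCoveringMap p)
    (hp' : Function.Surjective p) (lam : IdealTriangulation V) :
    ∃ T₀ : lam.Face → LiftedFace lam p, ∀ j, (T₀ j).face = j := by
  have x : OpenTri := Classical.arbitrary _
  have : ∀ j, ∃ T : LiftedFace lam p, T.face = j := fun j => by
    obtain ⟨y, hy⟩ := hp' (openChar lam j x)
    obtain ⟨T, hT, -⟩ := LiftedFace.exists_of_proj_eq hp hy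
    exact ⟨T, hT⟩
  choose T₀ hT₀ using this
  exact ⟨T₀, hT₀⟩

/-- Each lifted face is `g T • T₀` for a unique `g T`, and crossing a side multiplies `g` on the
right by a transition element `τ` that depends only on the side. The `r (τ d)` are lifted to
matrices `M d`, the `r (g T)` to matrices `B₀ T`; the signs of `B₀` are then corrected so that
crossing a side is exactly multiplication by `M`. -/
theorem exists_lift_of_hom [T2Space X] [SimplyConnectedSpace E] (hp : IsCoveringMap p)
    (hp' : Function.Surjective p) (lam : IdealTriangulation V) (r : Deck p →* PSL2C) :
    ∃ rhat : Deck p →* SL2C, ∀ g, (QuotientGroup.mk (rhat g) : PSL2C) = r g := by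
  classical
  have := locallyPathConnectedSpace_cover hp
  obtain ⟨κ, hκ2, hκc, hκ1, hκ⟩ := exists_central_involution
  obtain ⟨T₀, hT₀⟩ := exists_face_representatives hp hp' lam
  have hg : ∀ T : LiftedFace lam p, ∃ γ : Deck p, γ • T₀ T.face = T := fun T =>
    LiftedFace.exists_smul_eq hp (hT₀ _)
  choose g hg using hg
  have hgsmul : ∀ γ T, g (γ • T) = γ * g T := fun γ T =>
    LiftedFace.smul_left_cancel hp (T := T₀ T.face)
      (by rw [mul_smul, hg T]; exact hg (γ • T))
  have hnbr : ∀ d : lam.Face × Fin 3, ∃ T', (T₀ d.1).Adjacent d.2 T' (lam.mate d).2 := fun d => by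
    obtain ⟨T', i', h⟩ := LiftedFace.exists_adjacent hp (T₀ d.1) d.2
    have h1 := h.1
    rw [hT₀] at h1
    exact ⟨T', by rw [show lam.mate d = _ from h1]; exact h⟩
  choose nbr hnbr using hnbr
  set τ : lam.Face × Fin 3 → Deck p := fun d => g (nbr d) with hτ
  have hgadj : ∀ (T T' : LiftedFace lam p) (i i' : Fin 3), T.Adjacent i T' i' →
      g T' = g T * τ (T.face, i) := fun T T' i i' h => by
    have h1 := (hnbr (T.face, i)).smul (g T)
    simp only [hg T] at h1
    rw [(h.unique hp h1).1, hgsmul]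
  have hτmate : ∀ d, τ (lam.mate d) = (τ d)⁻¹ := fun d => by
    have h1 := hnbr d
    have e1 := hgadj _ _ _ _ h1
    have e2 := hgadj _ _ _ _ h1.symm
    have h2 : ((nbr d).face, (lam.mate d).2) = lam.mate d := by
      rw [← h1.1, hT₀]
    rw [hT₀] at e1
    rw [h2] at e2
    rw [eq_inv_iff_mul_eq_one]
    rw [e1, mul_assoc] at e2
    have e3 : τ d * τ (lam.mate d) = 1 := by
      rwa [left_eq_mul] at e2
    exact (mul_eq_one_comm).1 e3
  obtain ⟨M, hM, hMmate⟩ := lam.exists_antisymm_lift (QuotientGroup.mk' (Subgroup.center SL2C))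
    (QuotientGroup.mk'_surjective _) (fun d => r (τ d)) (fun d => by rw [hτmate, map_inv])
  have hB0 : ∀ T : LiftedFace lam p, ∃ B : SL2C, (QuotientGroup.mk B : PSL2C) = r (g T) := fun T =>
    QuotientGroup.mk'_surjective _ _
  choose B₀ hB₀ using hB0
  have hmate : ∀ {T T' : LiftedFace lam p} {i i' : Fin 3}, T.Adjacent i T' i' →
      M (T'.face, i') = (M (T.face, i))⁻¹ := fun h => by rw [← h.1, hMmate]
  have hB₀adj : ∀ (T T' : LiftedFace lam p) (i i' : Fin 3), T.Adjacent i T' i' →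
      B₀ T' = B₀ T * M (T.face, i) ∨ B₀ T' = B₀ T * M (T.face, i) * κ := fun T T' i i' h => by
    refine hκ _ _ ?_
    rw [hB₀, QuotientGroup.mk_mul, hB₀, hgadj T T' i i' h, map_mul]
    exact congrArg _ (hM _)
  choose T₁ i₁ hT₁ using fun (T : LiftedFace lam p) (i : Fin 3) => LiftedFace.exists_adjacent hp T i
  -- The defect of `B₀`, an exponent of `κ` modulo 2, which is the same when the side is crossed
  -- backwards.
  set e : LiftedFace lam p → Fin 3 → ℤ := fun T i =>
    if B₀ (T₁ T i) = B₀ T * M (T.face, i) then 0 else 1 with he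
  have hT₁' : ∀ {T T' : LiftedFace lam p} {i i' : Fin 3}, T.Adjacent i T' i' → T₁ T i = T' :=
    fun h => ((hT₁ _ _).unique hp h).1
  have hesymm : ∀ (T T' : LiftedFace lam p) (i i' : Fin 3), T.Adjacent i T' i' →
      e T' i' = e T i := fun T T' i i' h => by
    simp only [he, hT₁' h, hT₁' h.symm, hmate h]
    refine if_congr ?_ rfl rfl
    rw [eq_mul_inv_iff_mul_eq, eq_comm]
  have hBe : ∀ (T T' : LiftedFace lam p) (i i' : Fin 3), T.Adjacent i T' i' →
      B₀ T' = B₀ T * M (T.face, i) * κ ^ e T i := fun T T' i i' h => by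
    simp only [he, hT₁' h]
    split_ifs with h1
    · rw [zpow_zero, mul_one, h1]
    · rw [zpow_one]
      exact (hB₀adj T T' i i' h).resolve_left h1
  obtain ⟨ω, hω, hωm⟩ := lam.exists_orientation
  -- The sign `ω` makes the defect antisymmetric, as a primitive requires, and is invisible in the
  -- exponent of `κ`.
  obtain ⟨n, hn⟩ := LiftedFace.exists_int_primitive hp (fun T i => ω (T.face, i) * e T i)
    (fun T T' i i' h => by
      simp only [hesymm T T' i i' h, ← h.1, hωm, neg_mul])
  have hκe : ∀ T i, κ ^ (e T i + ω (T.face, i) * e T i) = 1 := fun T i => by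
    rcases hω (T.face, i) with h | h
    · rw [h, one_mul, ← two_mul, zpow_mul]
      rw [show κ ^ (2 : ℤ) = κ ^ 2 from zpow_natCast κ 2, hκ2, one_zpow]
    · rw [h, neg_one_mul, add_neg_cancel, zpow_zero]
  set B : LiftedFace lam p → SL2C := fun T => B₀ T * κ ^ n T with hB
  have hBadj : ∀ (T T' : LiftedFace lam p) (i i' : Fin 3), T.Adjacent i T' i' →
      B T' = B T * M (T.face, i) := fun T T' i i' h => by
    have hc : Commute (κ ^ n T) (M (T.face, i)) := (hκc _).zpow_left _
    simp only [hB]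
    rw [hBe T T' i i' h, hn T T' i i' h, mul_assoc (B₀ T) (κ ^ n T), hc.eq, mul_assoc (B₀ T * _),
      ← zpow_add, show e T i + (n T + ω (T.face, i) * e T i) =
        n T + (e T i + ω (T.face, i) * e T i) by ring, zpow_add, hκe, mul_one, mul_assoc]
  have hBmk : ∀ T, (QuotientGroup.mk (B T) : PSL2C) = r (g T) := fun T => by
    simp only [hB]
    rw [QuotientGroup.mk_mul, QuotientGroup.mk_zpow, hκ1, one_zpow, mul_one, hB₀]
  obtain ⟨T⟩ : Nonempty (LiftedFace lam p) :=
    ⟨(LiftedFace.exists_map_eq hp lam (Classical.arbitrary E)).choose⟩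
  -- `B (γ • T) * (B T)⁻¹` does not depend on `T`: crossing a side multiplies both factors `B` on
  -- the right by the same `M`. This makes it multiplicative in `γ`.
  have hindep : ∀ (γ : Deck p) (T' : LiftedFace lam p),
      B (γ • T') = B (γ • T) * (B T)⁻¹ * B T' := fun γ =>
    LiftedFace.forall_of_adjacent hp _ (fun T₁ T₂ i i' h h' => by
      rw [hBadj _ _ _ _ (h.smul γ), hBadj _ _ _ _ h, LiftedFace.smul_face, h', mul_assoc])
      T (by group)
  refine ⟨⟨⟨fun γ => B (γ • T) * (B T)⁻¹, by simp⟩, fun γ γ' => ?_⟩, fun γ => ?_⟩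
  · simp only
    rw [mul_smul, hindep γ (γ' • T), mul_assoc]
  · change (QuotientGroup.mk (B (γ • T) * (B T)⁻¹) : PSL2C) = r γ
    rw [QuotientGroup.mk_mul, QuotientGroup.mk_inv, hBmk, hBmk, hgsmul, map_mul, mul_inv_cancel_right]

end

/-! ### The universal covering of a punctured disc -/

/-- The retraction of the plane to the half-plane of real part at most `R`. -/
def clampRe (R : ℝ) (q : ℂ) : ℂ := (min q.re R : ℝ) + q.im * Complex.I

@[simp] theorem clampRe_re (R : ℝ) (q : ℂ) : (clampRe R q).re = min q.re R := by simp [clampRe]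

theorem clampRe_of_le {R : ℝ} {q : ℂ} (h : q.re ≤ R) : clampRe R q = q := by
  rw [clampRe, min_eq_left h, Complex.re_add_im]

theorem continuous_clampRe (R : ℝ) : Continuous (clampRe R) := by
  unfold clampRe
  have h1 := Complex.continuous_re
  have h2 := Complex.continuous_im
  fun_prop

theorem exp_clampRe_add (R : ℝ) (q : ℂ) :
    Complex.exp (clampRe R (q + 2 * Real.pi * Complex.I)) = Complex.exp (clampRe R q) := by
  have : clampRe R (q + 2 * Real.pi * Complex.I) = clampRe R q + 2 * Real.pi * Complex.I := by
    simp [clampRe]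
    ring
  rw [this, Complex.exp_add, Complex.exp_two_pi_mul_I, mul_one]

section

variable {X : Type*} [TopologicalSpace X] [ChartedSpace ℂ X] {V : Finset X}
  {E : Type*} [TopologicalSpace E] {lam : IdealTriangulation V} {p : E → Punctured V}

/-- The closed disc of radius `ρ` in the chart at `v` contains no other puncture than `v`. -/
structure IsPunctureDisc (V : Finset X) (v : X) (ρ : ℝ) : Prop where
  pos : 0 < ρ
  subset_target : Metric.closedBall (chartAt ℂ v v) ρ ⊆ (chartAt ℂ v).target
  eq_of_mem : ∀ v' ∈ V, v' ∈ (chartAt ℂ v).symm '' Metric.closedBall (chartAt ℂ v v) ρ → v' = v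

theorem exists_isPunctureDisc [T2Space X] (V : Finset X) (v : X) :
    ∃ ρ, IsPunctureDisc V v ρ := by
  classical
  set φ := chartAt ℂ v
  have hφ : φ v ∈ φ.target := mem_chart_target ℂ v
  have hc : IsClosed ((V.erase v : Finset X) : Set X) := (V.erase v).finite_toSet.isClosed
  have hopen : IsOpen (φ.target ∩ φ.symm ⁻¹' ((V.erase v : Finset X) : Set X)ᶜ) :=
    φ.isOpen_inter_preimage_symm hc.isOpen_compl
  have hmem : φ v ∈ φ.target ∩ φ.symm ⁻¹' ((V.erase v : Finset X) : Set X)ᶜ := by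
    refine ⟨hφ, ?_⟩
    rw [mem_preimage, φ.left_inv (mem_chart_source ℂ v)]
    simp
  obtain ⟨ρ, hρ, h⟩ := Metric.nhds_basis_closedBall.mem_iff.1 (hopen.mem_nhds hmem)
  refine ⟨ρ, hρ, fun x hx => (h hx).1, ?_⟩
  rintro v' hv' ⟨x, hx, rfl⟩
  by_contra hne
  exact (h hx).2 (Finset.mem_coe.2 (Finset.mem_erase.2 ⟨hne, hv'⟩))

namespace IsPunctureDisc

variable {v : X} {ρ : ℝ}

theorem add_exp_mem (h : IsPunctureDisc V v ρ) (q : ℂ) :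
    chartAt ℂ v v + Complex.exp (clampRe (Real.log ρ) q) ∈
      Metric.closedBall (chartAt ℂ v v) ρ := by
  rw [Metric.mem_closedBall, dist_eq_norm, add_sub_cancel_left, Complex.norm_exp, clampRe_re]
  calc Real.exp (min q.re (Real.log ρ)) ≤ Real.exp (Real.log ρ) :=
        Real.exp_le_exp.2 (min_le_right _ _)
    _ = ρ := Real.exp_log h.pos

/-- The universal covering of the punctured disc, precomposed with a retraction of the plane to a
half-plane. -/
def polar (h : IsPunctureDisc V v ρ) : C(ℂ, Punctured V) where
  toFun q := ⟨(chartAt ℂ v).symm (chartAt ℂ v v + Complex.exp (clampRe (Real.log ρ) q)), fun hV => by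
    have h1 := h.eq_of_mem _ hV ⟨_, h.add_exp_mem q, rfl⟩
    have h2 := congrArg (chartAt ℂ v) h1
    rw [(chartAt ℂ v).right_inv (h.subset_target (h.add_exp_mem q)), add_eq_left] at h2
    exact Complex.exp_ne_zero _ h2⟩
  continuous_toFun := by
    refine Continuous.subtype_mk ?_ _
    refine (chartAt ℂ v).continuousOn_symm.comp_continuous ?_
      fun q => h.subset_target (h.add_exp_mem q)
    exact continuous_const.add (Complex.continuous_exp.comp (continuous_clampRe _))

theorem chart_polar (h : IsPunctureDisc V v ρ) (q : ℂ) :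
    chartAt ℂ v (h.polar q).1 = chartAt ℂ v v + Complex.exp (clampRe (Real.log ρ) q) :=
  (chartAt ℂ v).right_inv (h.subset_target (h.add_exp_mem q))

theorem polar_mem_source (h : IsPunctureDisc V v ρ) (q : ℂ) :
    (h.polar q).1 ∈ (chartAt ℂ v).source :=
  (chartAt ℂ v).map_target (h.subset_target (h.add_exp_mem q))

theorem polar_add (h : IsPunctureDisc V v ρ) (q : ℂ) :
    h.polar (q + 2 * Real.pi * Complex.I) = h.polar q := by
  refine Subtype.ext ?_
  simp only [polar, ContinuousMap.coe_mk, exp_clampRe_add]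

theorem polar_eq (h : IsPunctureDisc V v ρ) {x : Punctured V} {q : ℂ}
    (hx : x.1 ∈ (chartAt ℂ v).source) (hq : Complex.exp q = chartAt ℂ v x.1 - chartAt ℂ v v)
    (hρ : ‖chartAt ℂ v x.1 - chartAt ℂ v v‖ ≤ ρ) : h.polar q = x := by
  have hre : q.re ≤ Real.log ρ := by
    rw [← hq, Complex.norm_exp] at hρ
    rwa [Real.le_log_iff_exp_le h.pos]
  refine Subtype.ext ?_
  simp only [polar, ContinuousMap.coe_mk]
  rw [clampRe_of_le hre, hq, add_sub_cancel, (chartAt ℂ v).left_inv hx]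

/-- `Φ` is a lift of the polar coordinates of a punctured disc at `v`, along whose fundamental loop
the monodromy is `γ`. -/
structure IsLift (h : IsPunctureDisc V v ρ) (p : E → Punctured V) (γ : Deck p) (Φ : C(ℂ, E)) :
    Prop where
  proj_eq : ∀ q, p (Φ q) = h.polar q
  monodromy : ∀ q, Φ (q + 2 * Real.pi * Complex.I) = γ.1 (Φ q)

/-- Translation by `2πi` does not change `polar`, so it turns `Φ` into another lift; the deck
transformation matching the two at `q₀` matches them on the whole plane. -/
theorem exists_isLift [T2Space X] [SimplyConnectedSpace E] (h : IsPunctureDisc V v ρ)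
    (hp : IsCoveringMap p) {q₀ : ℂ} {y : E} (hy : p y = h.polar q₀) :
    ∃ (γ : Deck p) (Φ : C(ℂ, E)), h.IsLift p γ Φ ∧ Φ q₀ = y := by
  have := locallyPathConnectedSpace_cover hp
  obtain ⟨Φ, h0, hΦ⟩ := (hp.existsUnique_continuousMap_lifts h.polar q₀ y hy).exists
  have hΦ' : ∀ q, p (Φ q) = h.polar q := congrFun hΦ
  obtain ⟨γ, hγ⟩ := Deck.exists_apply_eq hp (y := Φ q₀) (y' := Φ (q₀ + 2 * Real.pi * Complex.I))
    (by rw [hΦ', hΦ', h.polar_add])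
  refine ⟨γ, Φ, ⟨hΦ', fun q => ?_⟩, h0⟩
  refine congrFun (hp.eq_of_comp_eq (g₁ := fun q => Φ (q + 2 * Real.pi * Complex.I))
    (g₂ := fun q => γ.1 (Φ q)) (Φ.continuous.comp (continuous_id.add continuous_const))
    (γ.1.continuous.comp Φ.continuous) ?_ q₀ hγ.symm) q
  funext q
  simp only [Function.comp]
  rw [Deck.proj_apply γ, hΦ', hΦ', h.polar_add]

/-- The loop is lifted by the image under `Φ` of the vertical segment from `q` to `q + 2πi`. -/
theorem IsLift.isPunctureLoopAt {h : IsPunctureDisc V v ρ} {γ : Deck p} {Φ : C(ℂ, E)}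
    (hΦ : h.IsLift p γ Φ) {q : ℂ} (hq : q.re ≤ Real.log ρ) : IsPunctureLoopAt p v (Φ q) γ := by
  have hw : chartAt ℂ v (p (Φ q)).1 - chartAt ℂ v v = Complex.exp q := by
    rw [hΦ.proj_eq, h.chart_polar, add_sub_cancel_left, clampRe_of_le hq]
  have hn : ‖Complex.exp q‖ ≤ ρ := by
    rw [Complex.norm_exp, ← Real.exp_log h.pos]
    exact Real.exp_le_exp.2 hq
  have hsub : Metric.closedBall (chartAt ℂ v v) ‖Complex.exp q‖ ⊆
    Metric.closedBall (chartAt ℂ v v) ρ := Metric.closedBall_subset_closedBall hn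
  simp only [IsPunctureLoopAt, hw]
  refine ⟨by rw [hΦ.proj_eq]; exact h.polar_mem_source q, hsub.trans h.subset_target,
    fun v' hv' hv => h.eq_of_mem v' hv' (image_mono hsub hv),
    fun t => Φ (q + 2 * Real.pi * (t : ℝ) * Complex.I), by fun_prop, by simp, ?_, fun t => ?_⟩
  · rw [← hΦ.monodromy]
    simp
  · rw [hΦ.proj_eq]
    simp only [polar, ContinuousMap.coe_mk]
    rw [clampRe_of_le (by simpa using hq), Complex.exp_add]

theorem exists_isLift_of_isPunctureLoop [T2Space X] [SimplyConnectedSpace E]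
    (hp : IsCoveringMap p) (hv : v ∈ V) {γ : Deck p} (hγ : IsPunctureLoop p v γ) :
    ∃ (ρ : ℝ) (h : IsPunctureDisc V v ρ) (Φ : C(ℂ, E)), h.IsLift p γ Φ := by
  obtain ⟨y, h1, h2, h3, q, hq, hq0, hq1, hqt⟩ := hγ
  set w : ℂ := chartAt ℂ v (p y).1 - chartAt ℂ v v with hw
  have hw0 : w ≠ 0 := fun h => (p y).2 (by
    rw [(chartAt ℂ v).injOn h1 (mem_chart_source ℂ v) (sub_eq_zero.1 h)]
    exact hv)
  -- The disc is the one bounded by the loop, so that `log w` lies on the boundary of the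
  -- half-plane, where the retraction is the identity.
  have hd : IsPunctureDisc V v ‖w‖ := ⟨norm_pos_iff.2 hw0, h2, h3⟩
  have hre : (Complex.log w).re ≤ Real.log ‖w‖ := (Complex.log_re w).le
  have hlog : p y = hd.polar (Complex.log w) :=
    (hd.polar_eq h1 (Complex.exp_log hw0) le_rfl).symm
  obtain ⟨γ', Φ, hΦ, hΦ0⟩ := hd.exists_isLift hp hlog
  have key := hp.eq_of_comp_eq (g₁ := q)
    (g₂ := fun t : I => Φ (Complex.log w + 2 * Real.pi * (t : ℝ) * Complex.I)) hq (by fun_prop)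
    (by
      funext t
      simp only [Function.comp, hΦ.proj_eq]
      refine Subtype.ext ?_
      rw [hqt]
      simp only [polar, ContinuousMap.coe_mk]
      rw [clampRe_of_le (by simpa using hre), Complex.exp_add, Complex.exp_log hw0]) 0
    (by simp [hq0, hΦ0])
  have : γ' = γ := Deck.eq_of_apply_eq hp (y := y) (by
    rw [← hq1, key, ← hΦ0, ← hΦ.monodromy]
    simp)
  exact ⟨‖w‖, hd, Φ, this ▸ hΦ⟩

end IsPunctureDisc

theorem exists_isPunctureLoop [T2Space X] [SimplyConnectedSpace E] (hp : IsCoveringMap p)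
    (hp' : Function.Surjective p) (v : X) : ∃ γ : Deck p, IsPunctureLoop p v γ := by
  obtain ⟨ρ, h⟩ := exists_isPunctureDisc V v
  obtain ⟨y, hy⟩ := hp' (h.polar (Real.log ρ : ℝ))
  obtain ⟨γ, Φ, hΦ, -⟩ := h.exists_isLift hp hy
  exact ⟨γ, _, hΦ.isPunctureLoopAt (q := (Real.log ρ : ℝ)) (by simp)⟩

/-! ### Lifted faces near a puncture -/

namespace IsPunctureDisc

variable {v : X} {ρ : ℝ}

theorem exists_corner_mem (h : IsPunctureDisc V v ρ) (lam : IdealTriangulation V) :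
    ∃ δ : ℝ, 0 < δ ∧ ∀ c : lam.Face × Fin 3, lam.vertexAt c = v → ∀ x ∈ OpenTri.corner c.2 δ,
      (openChar lam c.1 x).1 ∈ (chartAt ℂ v).source ∧
        ‖chartAt ℂ v (openChar lam c.1 x).1 - chartAt ℂ v v‖ ≤ ρ := by
  have hex : ∀ c : lam.Face × Fin 3, ∃ δ : ℝ, 0 < δ ∧ (lam.vertexAt c = v →
      ∀ x ∈ OpenTri.corner c.2 δ, (openChar lam c.1 x).1 ∈ (chartAt ℂ v).source ∧
        ‖chartAt ℂ v (openChar lam c.1 x).1 - chartAt ℂ v v‖ ≤ ρ) := by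
    intro c
    by_cases hc : lam.vertexAt c = v
    · have hU : (chartAt ℂ v).source ∩ chartAt ℂ v ⁻¹' Metric.ball (chartAt ℂ v v) ρ ∈ 𝓝 v :=
        ((chartAt ℂ v).isOpen_inter_preimage Metric.isOpen_ball).mem_nhds
          ⟨mem_chart_source ℂ v, Metric.mem_ball_self h.pos⟩
      rw [← hc] at hU
      obtain ⟨δ, hδ, h'⟩ := Tri.exists_forall_mem ((lam.continuous_char c.1).continuousAt hU)
      refine ⟨δ, hδ, fun _ x hx => ?_⟩
      have := h' x.1 hx
      rw [hc] at this
      exact ⟨this.1, by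
        rw [← dist_eq_norm]
        exact (Metric.mem_ball.1 this.2).le⟩
    · exact ⟨1, one_pos, fun h' => absurd h' hc⟩
  choose δ hδ h' using hex
  by_cases hne : Nonempty (lam.Face × Fin 3)
  · obtain ⟨c₀, hc₀⟩ := Finite.exists_min δ
    exact ⟨δ c₀, hδ c₀, fun c hc x hx => h' c hc x
      (lt_of_le_of_lt (sub_le_sub_left (hc₀ c) 1) hx)⟩
  · exact ⟨1, one_pos, fun c => absurd ⟨c⟩ hne⟩

/-- A corner is contractible, so the coordinate centred at the puncture has a logarithm `L` on it,
and `T.map` coincides with `Φ ∘ L` there. Hence the same `γ` serves at all its points. -/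
theorem IsLift.isPunctureLoopAt_corner {h : IsPunctureDisc V v ρ} {γ : Deck p} {Φ : C(ℂ, E)}
    (hΦ : h.IsLift p γ Φ) (hp : IsCoveringMap p) (hv : v ∈ V) {δ : ℝ} (hδ : 0 < δ)
    {c : lam.Face × Fin 3}
    (hc : ∀ x ∈ OpenTri.corner c.2 δ, (openChar lam c.1 x).1 ∈ (chartAt ℂ v).source ∧
      ‖chartAt ℂ v (openChar lam c.1 x).1 - chartAt ℂ v v‖ ≤ ρ)
    {T : LiftedFace lam p} (hT : T.face = c.1) {x₀ : OpenTri} (hx₀ : x₀ ∈ OpenTri.corner c.2 δ)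
    {q₀ : ℂ} (hq₀ : Complex.exp q₀ = chartAt ℂ v (openChar lam c.1 x₀).1 - chartAt ℂ v v)
    (h₀ : T.map x₀ = Φ q₀) {x : OpenTri} (hx : x ∈ OpenTri.corner c.2 δ) :
    IsPunctureLoopAt p v (T.map x) γ := by
  have := OpenTri.contractibleSpace_corner c.2 hδ
  have := OpenTri.locallyPathConnectedSpace_corner c.2 δ
  set g : OpenTri.corner c.2 δ → ℂ := fun x =>
    chartAt ℂ v (openChar lam c.1 x.1).1 - chartAt ℂ v v with hg
  have hg0 : ∀ x, g x ≠ 0 := fun x h0 => (openChar lam c.1 x.1).2 (by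
    rw [(chartAt ℂ v).injOn (hc x x.2).1 (mem_chart_source ℂ v) (sub_eq_zero.1 h0)]
    exact hv)
  have hgc : Continuous g :=
    ((chartAt ℂ v).continuousOn.comp_continuous
      (f := fun x : OpenTri.corner c.2 δ => (openChar lam c.1 x.1).1)
      (continuous_subtype_val.comp ((continuous_openChar c.1).comp continuous_subtype_val))
      fun x => (hc x x.2).1).sub continuous_const
  obtain ⟨L, hL0, hL⟩ := (Complex.isCoveringMapOn_exp.existsUnique_continuousMap_lifts ⟨g, hgc⟩
    (a₀ := ⟨x₀, hx₀⟩) (e₀ := q₀) hq₀ hg0).exists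
  have hL' : ∀ x, Complex.exp (L x) = g x := congrFun hL
  have key := hp.eq_of_comp_eq (g₁ := fun x : OpenTri.corner c.2 δ => T.map x)
    (g₂ := fun x => Φ (L x)) (T.continuous_map.comp continuous_subtype_val)
    (Φ.continuous.comp L.continuous) (by
      funext x
      simp only [Function.comp, hΦ.proj_eq, T.proj_map, hT]
      exact (h.polar_eq (hc x x.2).1 (hL' x) (hc x x.2).2).symm) ⟨x₀, hx₀⟩ (by simp only [hL0, h₀])
  rw [show T.map x = Φ (L ⟨x, hx⟩) from congrFun key ⟨x, hx⟩]
  refine hΦ.isPunctureLoopAt ?_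
  rw [Real.le_log_iff_exp_le h.pos, ← Complex.norm_exp, hL']
  exact (hc x hx).2

end IsPunctureDisc

/-! ### The lifted faces met around a puncture. -/

theorem LiftedFace.exists_chain (hp : IsCoveringMap p) (T₀ : LiftedFace lam p)
    {c : lam.Face × Fin 3} (h₀ : T₀.face = c.1) :
    ∃ T : ℕ → LiftedFace lam p, T 0 = T₀ ∧ (∀ k, (T k).face = (lam.turn^[k] c).1) ∧
      ∀ k, (T k).Adjacent ((lam.turn^[k] c).2 + 2) (T (k + 1)) (lam.turn^[k + 1] c).2 := by
  choose N i' hN using fun (T : LiftedFace lam p) (i : Fin 3) => LiftedFace.exists_adjacent hp T i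
  set T : ℕ → LiftedFace lam p := fun k =>
    Nat.rec T₀ (fun k S => N S ((lam.turn^[k] c).2 + 2)) k with hT
  have hsucc : ∀ k, T (k + 1) = N (T k) ((lam.turn^[k] c).2 + 2) := fun k => rfl
  have hm : ∀ k, (T k).face = (lam.turn^[k] c).1 →
      lam.turn^[k + 1] c = ((T (k + 1)).face, i' (T k) ((lam.turn^[k] c).2 + 2)) := fun k h => by
    rw [Function.iterate_succ_apply', hsucc, ← (hN _ _).1, h]
    rfl
  have hface : ∀ k, (T k).face = (lam.turn^[k] c).1 := fun k => by
    induction k with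
    | zero => exact h₀
    | succ k ih => rw [hm k ih]
  refine ⟨T, rfl, hface, fun k => ?_⟩
  have := hN (T k) ((lam.turn^[k] c).2 + 2)
  rw [← hsucc] at this
  rwa [hm k (hface k)]

namespace IdealTriangulation

/-- The value `s = 1` is included: the end of a link is glued to the beginning of the next one, to
which `linkLoop` assigns the parameter `k + 1`. -/
theorem linkLoop_natCast_add (lam : IdealTriangulation V) (c : lam.Face × Fin 3) (ε : I) (k : ℕ)
    (s : I) : lam.linkLoop c ε (k + s) =
      lam.char (lam.turn^[k] c).1 (Tri.link (lam.turn^[k] c).2 ε s) := by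
  rcases s.2.2.eq_or_lt with hs | hs
  · obtain rfl : s = 1 := Subtype.ext hs
    have h1 : ((k : ℝ) + ((1 : I) : ℝ)) = ((k + 1 : ℕ) : ℝ) := by simp
    have h2 : (⟨Int.fract ((k + 1 : ℕ) : ℝ), unitInterval.fract_mem _⟩ : I) = 0 :=
      Subtype.ext (Int.fract_natCast _)
    rw [Triangulation.linkLoop, h1, Nat.floor_natCast, h2, Tri.link_zero, Tri.link_one]
    have := lam.char_side ((lam.turn^[k] c).1, (lam.turn^[k] c).2 + 2) (σ ε)
    rw [unitInterval.symm_symm] at this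
    rw [← this, Function.iterate_succ_apply']
    rfl
  · have h1 : ⌊(k : ℝ) + s⌋₊ = k := by
      rw [Nat.floor_eq_iff (by have := s.2.1; positivity)]
      exact ⟨by linarith [s.2.1], by linarith⟩
    have h2 : (⟨Int.fract ((k : ℝ) + s), unitInterval.fract_mem _⟩ : I) = s :=
      Subtype.ext (by
        change Int.fract ((k : ℝ) + s) = s
        rw [Int.fract_natCast_add]
        exact Int.fract_eq_self.2 ⟨s.2.1, hs⟩)
    rw [Triangulation.linkLoop, h1, h2]

end IdealTriangulation

/-- The link loop winds once, so its logarithm `Q` increases by `2πi`. The path `Φ ∘ Q` lifts this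
loop, runs through the successive faces of the chain, and ends at the image of its origin under `γ`.
-/
theorem exists_chain_around_puncture [T2Space X] [SimplyConnectedSpace E] (hp : IsCoveringMap p)
    {c : lam.Face × Fin 3} {γ : Deck p} (hγ : IsPunctureLoop p (lam.vertexAt c) γ) :
    ∃ T : ℕ → LiftedFace lam p, (∀ k, (T k).face = (lam.turn^[k] c).1) ∧
      (∀ k, (T k).Adjacent ((lam.turn^[k] c).2 + 2) (T (k + 1)) (lam.turn^[k + 1] c).2) ∧
      T (lam.valence c) = γ • T 0 ∧ ∀ᶠ x in OpenTri.nhdsVertex c.2,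
        IsPunctureLoopAt p (lam.vertexAt c) ((T 0).map x) γ := by
  have hv := lam.vertexAt_mem c
  obtain ⟨ρ, h, Φ, hΦ⟩ := IsPunctureDisc.exists_isLift_of_isPunctureLoop hp hv hγ
  obtain ⟨δ, hδ, hcorner⟩ := h.exists_corner_mem lam
  set v := lam.vertexAt c with hv'
  set n := lam.valence c with hn
  obtain ⟨ε, hwind, hε0, hεδ, hε1⟩ : ∃ ε : I,
      WindsOnce (fun t => chartAt ℂ v (lam.linkLoop c ε t) - chartAt ℂ v v) n ∧
      ε ≠ 0 ∧ (ε : ℝ) < δ ∧ (ε : ℝ) < 1 := by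
    have h1 : ∀ᶠ ε : I in 𝓝[≠] 0, (ε : ℝ) < min δ 1 :=
      nhdsWithin_le_nhds (continuous_subtype_val.continuousAt.eventually
        (gt_mem_nhds (lt_min hδ one_pos)))
    obtain ⟨ε, h1, h2, h3⟩ := ((lam.counterclockwise c).and (h1.and self_mem_nhdsWithin)).exists
    exact ⟨ε, h1, h3, h2.trans_le (min_le_left _ _), h2.trans_le (min_le_right _ _)⟩
  have hε : (ε : ℝ) ∈ Ioo (0 : ℝ) 1 := ⟨unitInterval.pos_iff_ne_zero.2 hε0, hε1⟩
  obtain ⟨θ, hθc, hθ, hθT⟩ := hwind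
  set ck : ℕ → lam.Face × Fin 3 := fun k => lam.turn^[k] c with hck
  have hckv : ∀ k, lam.vertexAt (ck k) = v := fun k => lam.vertexAt_iterate c k
  set z : ℝ → ℂ := fun t => chartAt ℂ v (lam.linkLoop c ε t) - chartAt ℂ v v with hz
  set Q : ℝ → ℂ := fun t => (Real.log ‖z t‖ : ℝ) + θ t * Complex.I with hQ
  have hexp : ∀ t ∈ Icc (0 : ℝ) n, Complex.exp (Q t) = z t := fun t ht => by
    obtain ⟨h0, h1⟩ := hθ t ht
    rw [hQ]
    simp only
    rw [Complex.exp_add, ← Complex.ofReal_exp, Real.exp_log (norm_pos_iff.2 h0)]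
    exact h1.symm
  set lk : ℕ → I → OpenTri := fun k s => OpenTri.link (ck k).2 ε hε s with hlk
  have hloop : ∀ (k : ℕ) (s : I), lam.linkLoop c ε (k + s) = (openChar lam (ck k).1 (lk k s)).1 :=
    fun k s => lam.linkLoop_natCast_add c ε k s
  have hmem : ∀ (k : ℕ), k < n → ∀ s : I, (k + s : ℝ) ∈ Icc (0 : ℝ) n := fun k hk s => by
    have : (k + 1 : ℝ) ≤ n := by exact_mod_cast hk
    have h0 : (0 : ℝ) ≤ k := Nat.cast_nonneg k
    exact ⟨by linarith [s.2.1], by linarith [s.2.2]⟩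
  have hcrn : ∀ k s, lk k s ∈ OpenTri.corner (ck k).2 δ := fun k s =>
    OpenTri.link_mem_corner _ _ _ _ hεδ
  have hpolar : ∀ (k : ℕ) (s : I), (k + s : ℝ) ∈ Icc (0 : ℝ) n →
      h.polar (Q (k + s)) = openChar lam (ck k).1 (lk k s) := fun k s hks => by
    have := hcorner (ck k) (hckv k) (lk k s) (hcrn k s)
    refine h.polar_eq this.1 ?_ this.2
    rw [hexp _ hks, hz]
    simp only [hloop]
  -- Continuity is needed only on each unit interval, where the loop stays in one face.
  have hQc : ∀ k : ℕ, k < n → Continuous fun s : I => Q (k + s) := fun k hk => by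
    have h1 : Continuous fun s : I => z (k + s) := by
      simp only [hz, hloop]
      exact ((chartAt ℂ v).continuousOn.comp_continuous (continuous_subtype_val.comp
        ((continuous_openChar _).comp (OpenTri.continuous_link _ _ _)))
        fun s => (hcorner (ck k) (hckv k) (lk k s) (hcrn k s)).1).sub continuous_const
    have h2 : Continuous fun s : I => θ (k + s) :=
      hθc.comp_continuous (by fun_prop) (hmem k hk)
    have h3 : Continuous fun s : I => Real.log ‖z (k + s)‖ :=
      h1.norm.log fun s => norm_ne_zero_iff.2 (hθ _ (hmem k hk s)).1
    exact (Complex.continuous_ofReal.comp h3).add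
      ((Complex.continuous_ofReal.comp h2).mul continuous_const)
  have h00 : ((0 : ℕ) + ((0 : I) : ℝ) : ℝ) ∈ Icc (0 : ℝ) n := by simp
  -- Starting the chain on the image of `Φ` makes its monodromy `γ` itself, and not just a conjugate
  -- of it.
  obtain ⟨T₀, hT₀, hT₀'⟩ := LiftedFace.exists_of_proj_eq hp (lam := lam) (j := c.1) (x := lk 0 0)
    (y := Φ (Q ((0 : ℕ) + ((0 : I) : ℝ)))) (by rw [hΦ.proj_eq]; exact hpolar 0 0 h00)
  obtain ⟨T, hT0, hTface, hTadj⟩ := LiftedFace.exists_chain hp T₀ hT₀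
  have hstep : ∀ k : ℕ, k ≤ n → (T k).map (lk k 0) = Φ (Q k) := fun k => by
    induction k with
    | zero =>
      intro _
      rw [hT0, hT₀']
      simp
    | succ k ih =>
      intro hk
      have hk' : k < n := hk
      have key := hp.eq_of_comp_eq (g₁ := fun s : I => (T k).map (lk k s))
        (g₂ := fun s : I => Φ (Q (k + s)))
        ((T k).continuous_map.comp (OpenTri.continuous_link _ _ _))
        (Φ.continuous.comp (hQc k hk')) (by
          funext s
          simp only [Function.comp, hΦ.proj_eq, (T k).proj_map, hpolar k s (hmem k hk' s), hTface]
          rfl) 0 (by simpa using ih hk'.le)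
      have h1 := congrFun key 1
      simp only [Icc.coe_one] at h1
      rw [Nat.cast_add, Nat.cast_one, ← h1]
      refine ((hTadj k).2 (lk k 1) (lk (k + 1) 0) (σ ε) (Tri.link_one _ _) ?_).symm
      rw [unitInterval.symm_symm]
      exact Tri.link_zero _ _
  refine ⟨T, hTface, hTadj, ?_, ?_⟩
  · have hcn : ck n = c := Function.iterate_minimalPeriod
    have hQn : Q n = Q 0 + 2 * Real.pi * Complex.I := by
      have hzn : z n = z 0 := by
        have e1 := hloop n 0
        have e2 := hloop 0 0
        simp only [Icc.coe_zero, add_zero, Nat.cast_zero] at e1 e2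
        simp only [hz, e1, e2, hlk, hcn]
        rfl
      have : θ n = θ 0 + 2 * Real.pi := by linarith
      simp only [hQ, hzn, this]
      push_cast
      ring
    have h1 := hstep n le_rfl
    have h2 := hstep 0 (Nat.zero_le _)
    rw [Nat.cast_zero] at h2
    rw [hQn, hΦ.monodromy, ← h2] at h1
    have h3 : lk n 0 = lk 0 0 := by
      simp only [hlk, hcn]
      rfl
    rw [h3] at h1
    refine LiftedFace.eq_of_map_eq hp ?_ h1
    rw [LiftedFace.smul_face, hTface, hTface]
    exact congrArg Prod.fst hcn
  · filter_upwards [OpenTri.corner_mem c.2 hδ] with x hx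
    refine hΦ.isPunctureLoopAt_corner hp hv hδ (hcorner c rfl) (hTface 0) (hcrn 0 0)
      (q₀ := Q ((0 : ℕ) + ((0 : I) : ℝ))) ?_ (by rw [hT0, hT₀']) hx
    rw [hexp _ h00, hz]
    simp only [hloop]
    rfl

end

section

variable {X : Type*} [TopologicalSpace X] [ChartedSpace ℂ X] {V : Finset X}
  {E : Type*} [TopologicalSpace E] {lam : IdealTriangulation V} {p : E → Punctured V}

/-! ### Ideal vertices of pleated surfaces -/

theorem IsIdealImage.unique {f : E → H3} {T : LiftedFace lam p} {z z' : Fin 3 → Bdry}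
    (h : IsIdealImage f T z) (h' : IsIdealImage f T z') : z = z' :=
  funext fun a => (h.tendsto a).unique (h'.tendsto a)

/-- The glued sides have opposite directions; both vertices are the limit of `f` at the same end of
the common side. -/
theorem IsIdealImage.vertex_eq_of_adjacent {f : E → H3} {T T' : LiftedFace lam p} {i i' : Fin 3}
    {z z' : Fin 3 → Bdry} (h : IsIdealImage f T z) (h' : IsIdealImage f T' z')
    (hadj : T.Adjacent i T' i') : z' i' = z (i + 1) := by
  have h1 : TendsToIdeal (fun s => f (T'.map (OpenTri.side i' s))) _ (z' i') :=
    (h'.tendsto i').comp (OpenTri.tendsto_side_zero i')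
  have h2 : TendsToIdeal _ _ (z (i + 1)) := (h.tendsto (i + 1)).comp (OpenTri.tendsto_side_one i)
  refine h1.unique (Tendsto.congr (fun s => ?_) h2)
  have hs := s.2
  simp only
  rw [hadj.2 _ (OpenTri.side i' s) ⟨1 - s, by constructor <;> linarith [hs.1, hs.2]⟩ rfl]
  exact congrArg (Tri.side i') (Subtype.ext (by simp))

theorem IsPleatedSurface.smul_vertex {r : Deck p →* PSL2C} {f : E → H3}
    (hf : IsPleatedSurface lam r f) {γ : Deck p} {A : SL2C} (hA : (QuotientGroup.mk A : PSL2C) = r γ)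
    {T : LiftedFace lam p} {z z' : Fin 3 → Bdry} (h : IsIdealImage f T z)
    (h' : IsIdealImage f (γ • T) z') (a : Fin 3) : z' a = A • z a := by
  refine (h'.tendsto a).unique ?_
  have := (h.tendsto a).act A
  simpa only [LiftedFace.smul_map, hf.equivariant γ A hA] using this

/-- Nonzero vectors spanning the ideal vertices of the images of the lifted faces, chosen in an
equivariant way. -/
theorem IsPleatedSurface.exists_vectors [T2Space X] [SimplyConnectedSpace E] (hp : IsCoveringMap p)
    (hp' : Function.Surjective p) {r : Deck p →* PSL2C} {f : E → H3}
    (hf : IsPleatedSurface lam r f) (rhat : Deck p →* SL2C)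
    (hr : ∀ g, (QuotientGroup.mk (rhat g) : PSL2C) = r g) :
    ∃ U : LiftedFace lam p → Fin 3 → Fin 2 → ℂ,
      (∀ T z, IsIdealImage f T z → ∀ a, Spans (U T a) (z a)) ∧
      ∀ γ T a, U (γ • T) a = rhat γ • U T a := by
  have := locallyPathConnectedSpace_cover hp
  obtain ⟨T₀, hT₀⟩ := exists_face_representatives hp hp' lam
  have hg : ∀ T : LiftedFace lam p, ∃ γ : Deck p, γ • T₀ T.face = T := fun T =>
    LiftedFace.exists_smul_eq hp (hT₀ _)
  choose g hg using hg
  have hgsmul : ∀ γ T, g (γ • T) = γ * g T := fun γ T =>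
    LiftedFace.smul_left_cancel hp (T := T₀ T.face)
      (by rw [mul_smul, hg T]; exact hg (γ • T))
  choose Z hZ using hf.pleated
  -- Vectors are chosen for one lift of each face and transported by `rhat`. Since `g T` is unique,
  -- equivariance is automatic.
  refine ⟨fun T a => rhat (g T) • (Z (T₀ T.face) a).rep, fun T z hz a => ?_, fun γ T a => ?_⟩
  · rw [hf.smul_vertex (z' := z) (hr (g T)) (hZ (T₀ T.face)) (by rwa [hg]) a]
    exact (spans_rep _).smul _
  · simp only [hgsmul, map_mul, mul_smul, LiftedFace.smul_face]

/-- The ratio of the vectors at a common ideal vertex of two adjacent lifted faces. -/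
theorem exists_ratio [T2Space X] [SimplyConnectedSpace E] (hp : IsCoveringMap p)
    (hp' : Function.Surjective p) {f : E → H3}
    (hf : ∀ T : LiftedFace lam p, ∃ z, IsIdealImage f T z) (rhat : Deck p →* SL2C)
    {U : LiftedFace lam p → Fin 3 → Fin 2 → ℂ}
    (hU : ∀ T z, IsIdealImage f T z → ∀ a, Spans (U T a) (z a))
    (hUr : ∀ γ T a, U (γ • T) a = rhat γ • U T a) :
    ∃ m : lam.Face × Fin 3 → ℂ, ∀ (T T' : LiftedFace lam p) (i i' : Fin 3), T.Adjacent i T' i' →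
      m (T.face, i) ≠ 0 ∧ U T' i' = m (T.face, i) • U T (i + 1) := by
  have := locallyPathConnectedSpace_cover hp
  obtain ⟨T₀, hT₀⟩ := exists_face_representatives hp hp' lam
  -- The ratio is computed at one lift of each face; `rhat` acts linearly, so its translates have
  -- the same ratio.
  choose N k hN using fun d : lam.Face × Fin 3 => LiftedFace.exists_adjacent hp (T₀ d.1) d.2
  have hm : ∀ d : lam.Face × Fin 3, ∃ c : ℂ, c ≠ 0 ∧
      U (N d) (k d) = c • U (T₀ d.1) (d.2 + 1) := fun d => by
    obtain ⟨z, hz⟩ := hf (T₀ d.1)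
    obtain ⟨z', hz'⟩ := hf (N d)
    have h := hU _ _ hz' (k d)
    rw [hz.vertex_eq_of_adjacent hz' (hN d)] at h
    exact h.exists_eq_smul (hU _ _ hz _)
  choose m hm0 hm using hm
  refine ⟨m, fun T T' i i' h => ⟨hm0 _, ?_⟩⟩
  obtain ⟨γ, hγ⟩ := LiftedFace.exists_smul_eq hp (hT₀ T.face)
  have h1 := (hN (T.face, i)).smul γ
  simp only [hγ] at h1
  obtain ⟨rfl, rfl⟩ := h.unique hp h1
  rw [hUr, hm, smul_comm, ← hUr]
  simp only [hγ]

/-! ### The product of the edge weights. -/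

theorem prod_area_ratio {X : Type*} [TopologicalSpace X] (lam : Triangulation X) (D : lam.Face × Fin 3 → ℂ) (hD : ∀ d, D d ≠ 0) :
    ∏ d : lam.Face × Fin 3, D (d.1, d.2 + 1) / D (d.1, d.2 + 2) = 1 := by
  have h : ∀ b : Fin 3, ∏ d : lam.Face × Fin 3, D (d.1, d.2 + b) = ∏ d, D d := fun b =>
    Equiv.prod_comp ((Equiv.refl lam.Face).prodCongr (Equiv.addRight b)) D
  rw [Finset.prod_div_distrib, h, h, div_self (Finset.prod_ne_zero_iff.2 fun d _ => hD d)]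

/-- The total peripheral load is, up to sign, the product of the eigenvalues of the peripheral
elements. -/
theorem total_load_eq [T2Space X] [SimplyConnectedSpace E] (hp : IsCoveringMap p)
    (hp' : Function.Surjective p) (R : EnhancedHom p) {h : ℂ} (hh : HasTotalPeripheralLoad lam R h)
    (rhat : Deck p →* SL2C) (hr : ∀ g, (QuotientGroup.mk (rhat g) : PSL2C) = R.r g)
    (γ : V → Deck p) (a : V → ℂ) (hγ : ∀ v : V, IsPunctureLoop p v (γ v))
    (ha : ∀ v : V, ∀ u ∈ (R.ξ (Subgroup.zpowers (γ v))).submodule, rhat (γ v) • u = a v • u) :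
    h = (-1) ^ V.card * ∏ v, a v := by
  obtain ⟨x, ⟨f, ⟨hf, hξ⟩, hx⟩, rfl⟩ := hh
  obtain ⟨U, hU, hUr⟩ := hf.exists_vectors hp hp' rhat hr
  obtain ⟨m, hm⟩ := exists_ratio hp hp' hf.pleated rhat hU hUr
  obtain ⟨T₀, hT₀⟩ := exists_face_representatives hp hp' lam
  have := locallyPathConnectedSpace_cover hp
  -- These determinants depend only on the face, because `rhat` has values in `SL₂(ℂ)`.
  set D : lam.Face × Fin 3 → ℂ := fun d => area (U (T₀ d.1) d.2) (U (T₀ d.1) (d.2 + 1)) with hD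
  have hDT : ∀ (T : LiftedFace lam p) (i : Fin 3), area (U T i) (U T (i + 1)) = D (T.face, i) :=
    fun T i => by
      obtain ⟨g, hg⟩ := LiftedFace.exists_smul_eq hp (hT₀ T.face)
      conv_lhs => rw [← hg]
      rw [hUr, hUr, area_smul_smul]
  have hne : ∀ {T : LiftedFace lam p} {z}, IsIdealImage f T z → ∀ {i j : Fin 3}, i ≠ j →
      area (U T i) (U T j) ≠ 0 := fun hz i j hij =>
    (hU _ _ hz i).area_ne_zero (hU _ _ hz j) (hz.injective.ne hij)
  have hD0 : ∀ d, D d ≠ 0 := fun d => by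
    obtain ⟨z, hz⟩ := hf.pleated (T₀ d.1)
    exact hne hz (by simp)
  -- The contribution of one of the two faces adjacent to an edge to the cross-ratio.
  set y : lam.Face × Fin 3 → ℂ := fun d => m d * (D (d.1, d.2 + 1) / D (d.1, d.2 + 2)) with hy
  have hedge : ∀ e, ∃ d, lam.edge d = e ∧ x e = -(y d * y (lam.mate d)) := fun e => by
    obtain ⟨T, T', i, i', z, z', he, hadj, hz, hz', hsb⟩ := hx e
    refine ⟨(T.face, i), he, ?_⟩
    obtain ⟨m1, e1⟩ := hm T T' i i' hadj
    obtain ⟨m2, e2⟩ := hm T' T i' i hadj.symm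
    have v1 := hz.vertex_eq_of_adjacent hz' hadj
    have v2 := hz'.vertex_eq_of_adjacent hz hadj.symm
    have n01 : (i : Fin 3) ≠ i + 1 := by simp
    have n12 : (i + 1 : Fin 3) ≠ i + 2 := by simp
    have n02 : (i : Fin 3) ≠ i + 2 := by simp
    have n12' : (i' + 1 : Fin 3) ≠ i' + 2 := by simp
    have n02' : (i' : Fin 3) ≠ i' + 2 := by simp
    have hcr := hsb.eq_cross_ratio (hU _ _ hz i) (hU _ _ hz (i + 1)) (hU _ _ hz (i + 2))
      (hU _ _ hz' (i' + 2)) (hz.injective.ne n01) (hz.injective.ne n12) (hz.injective.ne n02)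
      (by rw [← v1]; exact hz'.injective.ne n02') (by rw [v2]; exact hz'.injective.ne n12')
    have s1 : (i + 1 + 1 : Fin 3) = i + 2 := by rw [add_assoc]; rfl
    have s2 : (i + 2 + 1 : Fin 3) = i := by rw [add_assoc]; simp
    have s1' : (i' + 1 + 1 : Fin 3) = i' + 2 := by rw [add_assoc]; rfl
    have s2' : (i' + 2 + 1 : Fin 3) = i' := by rw [add_assoc]; simp
    have a1 := hDT T (i + 1)
    have a2 := hDT T (i + 2)
    have a1' := hDT T' (i' + 1)
    have a2' := hDT T' (i' + 2)
    rw [s1] at a1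
    rw [s2, area_swap] at a2
    rw [s1'] at a1'
    rw [s2', area_swap, e1, area_smul_left] at a2'
    have d2 := hD0 (T.face, i + 2)
    have d2' := hD0 (T'.face, i' + 2)
    -- The vertices `i` and `i + 1` of `T` are the vertices `i' + 1` and `i'` of `T'`, so the mixed
    -- determinants reduce to those of `T'` by the ratios `m`.
    have a3 : area (U T i) (U T' (i' + 2)) = m (T'.face, i') * D (T'.face, i' + 1) := by
      rw [e2, area_smul_left, a1']
    have a4 : area (U T (i + 1)) (U T' (i' + 2)) = -(m (T.face, i))⁻¹ * D (T'.face, i' + 2) := by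
      rw [← a2']
      field_simp
    have a5 : area (U T i) (U T (i + 2)) = -D (T.face, i + 2) := by rw [← a2, neg_neg]
    rw [hcr, a1, a3, a4, a5, hadj.1, hy]
    field_simp
  choose d hd hxd using hedge
  have hprod : ∏ e, x e = (-1) ^ V.card * ∏ c, m c := by
    rw [Finset.prod_congr rfl fun e _ => hxd e, Finset.prod_neg, Finset.card_univ,
      lam.neg_one_pow_card_edge, lam.prod_edges y d hd, hy, Finset.prod_mul_distrib,
      prod_area_ratio _ D hD0, mul_one]
  have hcorner : ∀ v : V, ∃ c, lam.vertexAt c = v := fun v => (lam.mem_iff v.1).1 v.2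
  choose c hc using hcorner
  -- Turning from the corner `c` crosses the side `rotate c`, hence the reindexing before the sides
  -- are grouped by vertices.
  rw [hprod, ← Equiv.prod_comp lam.rotate m, ← lam.prod_corners _ c hc]
  congr 1
  refine Finset.prod_congr rfl fun v _ => ?_
  obtain ⟨T, hTface, hTadj, hTn, hTγ⟩ := exists_chain_around_puncture (lam := lam) hp (c := c v)
    (γ := γ v) (by rw [hc]; exact hγ v)
  -- All faces of the chain share the ideal vertex at the puncture, and the ratios of its successive
  -- vectors accumulate.
  have hchain : ∀ k : ℕ, U (T k) (lam.turn^[k] (c v)).2 =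
      (∏ k ∈ Finset.range k, m (lam.rotate (lam.turn^[k] (c v)))) • U (T 0) (c v).2 := fun k => by
    induction k with
    | zero => simp
    | succ k ih =>
      rw [(hm _ _ _ _ (hTadj k)).2, add_assoc, show (2 + 1 : Fin 3) = 0 from rfl, add_zero, ih,
        smul_smul, Finset.prod_range_succ, mul_comm, hTface]
      rfl
  obtain ⟨z, hz⟩ := hf.pleated (T 0)
  have h1 := hchain (lam.valence (c v))
  have hturn : lam.turn^[lam.valence (c v)] (c v) = c v := Function.iterate_minimalPeriod
  have hface : (T 0).face = (c v).1 := hTface 0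
  have hspan := hU _ _ hz (c v).2
  have hev : R.ξ (Subgroup.zpowers (γ v)) = z (c v).2 :=
    hξ (T 0) z hz (c v).2 (γ v) (by rw [hface]; exact hTγ)
  -- After a full turn the vector is both the accumulated multiple of the initial one and its image
  -- under `rhat (γ v)`.
  rw [hturn, hTn, hUr, ha v _ (by rw [hev]; exact hspan.2)] at h1
  exact (smul_left_injective ℂ hspan.1 h1).symm

theorem EnhancedHom.exists_eigenvalue (R : EnhancedHom p) (rhat : Deck p →* SL2C)
    (hr : ∀ g, (QuotientGroup.mk (rhat g) : PSL2C) = R.r g) {v : X} (hv : v ∈ V) {γ : Deck p}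
    (hγ : IsPunctureLoop p v γ) :
    ∃ a : ℂ, ∀ u ∈ (R.ξ (Subgroup.zpowers γ)).submodule, rhat γ • u = a • u := by
  set ζ := R.ξ (Subgroup.zpowers γ)
  have hfix : rhat γ • ζ = ζ := by
    have := R.fixed _ ⟨v, hv, γ, hγ, rfl⟩ γ (Subgroup.mem_zpowers γ)
    rwa [← hr] at this
  have h := (spans_rep ζ).smul (rhat γ)
  rw [hfix] at h
  obtain ⟨a, -, ha⟩ := h.exists_eq_smul (spans_rep ζ)
  refine ⟨a, fun u hu => ?_⟩
  rw [Projectivization.submodule_eq, Submodule.mem_span_singleton] at hu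
  obtain ⟨k, rfl⟩ := hu
  rw [smul_comm, ha, smul_comm]

end

end PeripheralLoad

end

/-! ### The theorem. -/

open PeripheralLoad in
theorem mainTheorem8 {X : Type*} [TopologicalSpace X] [T2Space X] [CompactSpace X]
    [ConnectedSpace X] [ChartedSpace ℂ X] (hX : IsOrientedAtlas X) (V : Finset X)
    {E : Type*} [TopologicalSpace E] [SimplyConnectedSpace E] (p : E → Punctured V)
    (hp : IsCoveringMap p) (hp' : Function.Surjective p) (R : EnhancedHom p) :
    (∀ (lam : IdealTriangulation V) (h : ℂ), HasTotalPeripheralLoad lam R h →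
      ∀ rhat : Deck p →* SL2C, (∀ g, (QuotientGroup.mk (rhat g) : PSL2C) = R.r g) →
      ∀ (γ : V → Deck p) (a : V → ℂ), (∀ v : V, IsPunctureLoop p v (γ v)) →
        (∀ v : V, ∀ u ∈ (R.ξ (Subgroup.zpowers (γ v))).submodule, rhat (γ v) • u = a v • u) →
        h = (-1) ^ V.card * ∏ v, a v) ∧
    (∀ (lam lam' : IdealTriangulation V) (h h' : ℂ), HasTotalPeripheralLoad lam R h →
      HasTotalPeripheralLoad lam' R h' → h = h') := by
  refine ⟨fun lam h hh rhat hr γ a hγ ha => total_load_eq hp hp' R hh rhat hr γ a hγ ha,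
    fun lam lam' h h' hh hh' => ?_⟩
  -- One lift, one choice of loops and their eigenvalues serve for both triangulations.
  obtain ⟨rhat, hr⟩ := exists_lift_of_hom hp hp' lam R.r
  choose γ hγ using fun v : V => exists_isPunctureLoop hp hp' v.1
  choose a ha using fun v : V => R.exists_eigenvalue rhat hr v.2 (hγ v)
  rw [total_load_eq hp hp' R hh rhat hr γ a hγ ha, total_load_eq hp hp' R hh' rhat hr γ a hγ ha]
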